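/- Let $(X,\theta,G)$ be a discrete partial dynamical system: $G$ is a group, $X$ a set, and $\theta$ consists of subsets $D_g\subseteq X$ and bijections $\theta_g:D_{g^{-1}}\to D_g$ ($g\in G$) such that $D_e=X$, $\theta_e=\mathrm{id}_X$, $\theta_h(D_{h^{-1}}\cap D_i)=D_h\cap D_{hi}$, and $\theta_h(\theta_i(x))=\theta_{hi}(x)$ for $x\in D_{i^{-1}}\cap D_{i^{-1}h^{-1}}$, for all $h,i\in G$. Let $\mathcal B$ be the Boolean algebra of subsets of $X$ generated by $\{D_g\mid g\in G\}$, and let $\hat X\subseteq\{0,1\}^{\mathcal B}$ be its dual (Stone) space, i.e. the compact space of Boolean homomorphisms $\phi:\mathcal B\to\{0,1\}$ with the topology of pointwise convergence. For $g\in G$ put $\hat D_g=\{\phi\in\hat X\mid\phi(D_g)=1\}$ and let $\hat\theta_g:\hat D_{g^{-1}}\to\hat D_g$ be the homeomorphism $\hat\theta_g(\phi)(A)=\phi(\theta_g^{-1}(A))$. Let $G$ act partially on the $C^*$-algebra $C(\hat X)$ by the closed ideals $\bar D_g=\{f\in C(\hat X)\mid f=0\text{ on }\hat X\setminus\hat D_g\}$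 and the isomorphisms $\bar\theta_g:\bar D_{g^{-1}}\to\bar D_g$ which send $f$ to the function equal to $f\circ\hat\theta_{g^{-1}}$ on $\hat D_g$ and to $0$ off $\hat D_g$. Let $C(\hat X)\rtimes_{\bar\theta}G$ be the (full) partial crossed product, i.e. the completion, with respect to the greatest $C^*$-seminorm, of the $*$-algebra of finite formal sums $\sum_g f_g\delta_g$ with $f_g\in\bar D_g$, with $(f\delta_g)(f'\delta_h)=\bar\theta_g(\bar\theta_g^{-1}(f)f')\delta_{gh}$ and $(f\delta_g)^*=\bar\theta_g^{-1}(f^*)\delta_{g^{-1}}$. Consider the following conditions on a family $(s_g)_{g\in G}$ of elements of a unital $C^*$-algebra: (a) the $s_g$ are partial isometries with commuting range projections $s_gs_g^*$; (b) $s_e=1$; (c) $s_{g^{-1}}=s_g^*$ for all $g\in G$; (d) $s_hs_i=s_hs_h^*s_{hi}$ for all $h,i\in G$; (e) the map $D_g\mapsto s_gs_g^*$ extends to a Boolean homomorphism from $\mathcal B$ to the Boolean algebra of projections of the unital abelian $C^*$-algebra generated by $\{s_gs_g^*\mid g\in G\}$ (with $p\wedge q=pq$, $p\vee q=p+q-pq$,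 $\neg p=1-p$). Theorem. For every discrete partial dynamical system $(X,\theta,G)$, the crossed product $C(\hat X)\rtimes_{\bar\theta}G$ is generated as a $C^*$-algebra by a family $(s_g)_{g\in G}$ satisfying (a)–(e), and whenever $\mathcal A$ is a $C^*$-algebra with a family $(S_g)_{g\in G}$ satisfying (a)–(e), there is a unique $*$-homomorphism $C(\hat X)\rtimes_{\bar\theta}G\to\mathcal A$ which maps $s_g$ to $S_g$ for every $g\in G$. Hence the universal $C^*$-algebra $C^*(X,\theta,G)$ generated by a family satisfying (a)–(e) exists. -/

import Mathlib

set_option linter.unusedSectionVars false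

noncomputable section

/-- A C*-seminorm on a complex unital `*`-algebra. -/
structure CStarSeminorm (R : Type*) [Ring R] [StarRing R] [Algebra ℂ R] extends Seminorm ℂ R where
  mul_le' : ∀ x y : R, toFun (x * y) ≤ toFun x * toFun y
  star_mul_self' : ∀ x : R, toFun (star x * x) = toFun x ^ 2

namespace CStarSeminorm

variable {R : Type*} [Ring R] [StarRing R] [Algebra ℂ R]

instance : CoeFun (CStarSeminorm R) (fun _ => R → ℝ) := ⟨fun p => p.toSeminorm⟩

theorem mul_le (p : CStarSeminorm R) (x y : R) : p (x * y) ≤ p x * p y := p.mul_le' x y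

theorem star_mul_self (p : CStarSeminorm R) (x : R) : p (star x * x) = p x ^ 2 :=
  p.star_mul_self' x

theorem le_star (p : CStarSeminorm R) (x : R) : p x ≤ p (star x) := by
  have h : p x ^ 2 ≤ p (star x) * p x := (p.star_mul_self x).symm.le.trans (p.mul_le _ _)
  rcases (apply_nonneg p.toSeminorm x).eq_or_lt with h0 | h0
  · rw [← h0]; exact apply_nonneg p.toSeminorm _
  · nlinarith

theorem star_eq (p : CStarSeminorm R) (x : R) : p (star x) = p x :=
  le_antisymm (by simpa using p.le_star (star x)) (p.le_star x)

/-- The `*`-algebra `R`, regarded as seminormed by `p`. -/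
def Carrier (_ : CStarSeminorm R) : Type _ := R

variable (p : CStarSeminorm R)

instance : SeminormedRing p.Carrier where
  __ := (p.toSeminorm.toAddGroupSeminorm.toSeminormedAddCommGroup :
    SeminormedAddCommGroup R)
  __ := (inferInstanceAs (Ring R) : Ring p.Carrier)
  norm_mul_le x y := p.mul_le x y

theorem norm_def (x : p.Carrier) : ‖x‖ = p (x : R) := rfl

instance : StarRing p.Carrier := inferInstanceAs (StarRing R)

instance : NormedAlgebra ℂ p.Carrier where
  __ := (inferInstanceAs (Algebra ℂ R) : Algebra ℂ p.Carrier)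
  norm_smul_le c x := (map_smul_eq_mul p.toSeminorm c x).le

instance [StarModule ℂ R] : StarModule ℂ p.Carrier := inferInstanceAs (StarModule ℂ R)

instance : NormedStarGroup p.Carrier where
  norm_star_le x := (p.star_eq x).le

end CStarSeminorm

namespace UniformSpace.Completion

variable {A : Type*} [SeminormedRing A] [StarRing A] [NormedStarGroup A]

instance instStarOfNormedStarGroup : Star (Completion A) where
  star := Completion.map star

theorem uniformContinuous_star' : UniformContinuous (star : A → A) :=
  (starNormedAddGroupHom (E := A)).uniformContinuous

theorem coe_star' (a : A) : ((star a : A) : Completion A) = star (a : Completion A) :=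
  (Completion.map_coe uniformContinuous_star' a).symm

theorem continuous_star' : Continuous (star : Completion A → Completion A) :=
  Completion.continuous_map

instance instStarRingOfNormedStarGroup : StarRing (Completion A) where
  star_involutive x := by
    induction x using Completion.induction_on with
    | hp => exact isClosed_eq (continuous_star'.comp continuous_star') continuous_id
    | ih a => rw [← coe_star', ← coe_star', star_star]
  star_mul x y := by
    induction x, y using Completion.induction_on₂ with
    | hp =>
      exact isClosed_eq (continuous_star'.comp continuous_mul)
        ((continuous_star'.comp continuous_snd).mul (continuous_star'.comp continuous_fst))
    | ih a b => rw [← coe_mul, ← coe_star', star_mul, coe_mul, coe_star', coe_star']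
  star_add x y := by
    induction x, y using Completion.induction_on₂ with
    | hp =>
      exact isClosed_eq (continuous_star'.comp continuous_add)
        ((continuous_star'.comp continuous_fst).add (continuous_star'.comp continuous_snd))
    | ih a b => rw [← coe_add, ← coe_star', star_add, coe_add, coe_star', coe_star']

end UniformSpace.Completion

namespace CStarSeminorm

open UniformSpace

variable {R : Type*} [Ring R] [StarRing R] [Algebra ℂ R] [StarModule ℂ R]

/-- The C*-algebra obtained from `R` by separating and completing with respect to `p`. -/
abbrev Completion (p : CStarSeminorm R) : Type _ := UniformSpace.Completion p.Carrier

instance instCStarAlgebraCompletion (p : CStarSeminorm R) : CStarAlgebra p.Completion where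
  __ := (inferInstance : NormedRing (UniformSpace.Completion p.Carrier))
  __ := (inferInstance : StarRing (UniformSpace.Completion p.Carrier))
  __ := (inferInstance : Algebra ℂ (UniformSpace.Completion p.Carrier))
  __ := (inferInstance : CompleteSpace (UniformSpace.Completion p.Carrier))
  norm_smul_le c x := norm_smul_le c x
  star_smul c x := by
    induction x using Completion.induction_on with
    | hp =>
      exact isClosed_eq (Completion.continuous_star'.comp (continuous_const_smul c))
        (Completion.continuous_star'.const_smul (star c))
    | ih a => rw [← Completion.coe_smul, ← Completion.coe_star', star_smul, Completion.coe_smul,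
        Completion.coe_star']
  norm_mul_self_le x := by
    induction x using Completion.induction_on with
    | hp =>
      exact isClosed_le (continuous_norm.mul continuous_norm)
        (continuous_norm.comp (Completion.continuous_star'.mul continuous_id))
    | ih a =>
      rw [← Completion.coe_star', ← Completion.coe_mul, Completion.norm_coe, Completion.norm_coe]
      exact ((sq ‖a‖).symm.trans (p.star_mul_self a).symm).le

/-- The canonical `*`-homomorphism into the completion. -/
def toCompletion (p : CStarSeminorm R) : R →⋆ₐ[ℂ] p.Completion where
  toFun x := ((show p.Carrier from x : p.Carrier) : p.Completion)
  map_one' := Completion.coe_one _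
  map_mul' x y := Completion.coe_mul (α := p.Carrier) x y
  map_zero' := Completion.coe_zero
  map_add' x y := Completion.coe_add (α := p.Carrier) x y
  commutes' _ := rfl
  map_star' x := Completion.coe_star' (A := p.Carrier) x

theorem norm_toCompletion (p : CStarSeminorm R) (x : R) : ‖p.toCompletion x‖ = p x :=
  Completion.norm_coe (E := p.Carrier) x

/-- On a C*-algebra every C*-seminorm is dominated by the norm. -/
theorem le_norm {A : Type*} [CStarAlgebra A] (p : CStarSeminorm A) (a : A) : p a ≤ ‖a‖ := by
  rw [← p.norm_toCompletion]
  exact NonUnitalStarAlgHom.norm_apply_le p.toCompletion a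

/-- The pullback of a C*-seminorm along a `*`-homomorphism. -/
def comap {S : Type*} [Ring S] [StarRing S] [Algebra ℂ S] (p : CStarSeminorm R)
    (f : S →⋆ₐ[ℂ] R) : CStarSeminorm S where
  toSeminorm := p.toSeminorm.comp (f : S →ₐ[ℂ] R).toLinearMap
  mul_le' x y := by
    have := p.mul_le (f x) (f y)
    rw [← map_mul] at this
    exact this
  star_mul_self' x := by
    have := p.star_mul_self (f x)
    rw [← map_star, ← map_mul] at this
    exact this

theorem comap_apply {S : Type*} [Ring S] [StarRing S] [Algebra ℂ S] (p : CStarSeminorm R)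
    (f : S →⋆ₐ[ℂ] R) (x : S) : p.comap f x = p (f x) := rfl

instance : Nonempty (CStarSeminorm R) := ⟨⟨0, fun _ _ => (zero_mul (0 : ℝ)).ge, fun _ => (zero_pow two_ne_zero).symm⟩⟩

/-- The greatest C*-seminorm on a `*`-algebra on which all C*-seminorms are pointwise
bounded. -/
def sup (h : ∀ x : R, BddAbove (Set.range fun p : CStarSeminorm R => p x)) :
    CStarSeminorm R where
  toFun x := ⨆ p : CStarSeminorm R, p x
  map_zero' := by
    have : ∀ p : CStarSeminorm R, p 0 = 0 := fun p => map_zero p.toSeminorm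
    simp [this]
  add_le' x y := ciSup_le fun p => (map_add_le_add p.toSeminorm x y).trans
    (add_le_add (le_ciSup (h x) p) (le_ciSup (h y) p))
  neg' x := by
    have : ∀ p : CStarSeminorm R, p (-x) = p x := fun p => map_neg_eq_map p.toSeminorm x
    simp [this]
  smul' c x := by
    have : ∀ p : CStarSeminorm R, p (c • x) = ‖c‖ * p x :=
      fun p => map_smul_eq_mul p.toSeminorm c x
    simp only [this]
    exact (Real.mul_iSup_of_nonneg (norm_nonneg c) _).symm
  mul_le' x y := ciSup_le fun p => (p.mul_le x y).trans
    (mul_le_mul (le_ciSup (h x) p) (le_ciSup (h y) p) (apply_nonneg p.toSeminorm _)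
      ((apply_nonneg p.toSeminorm _).trans (le_ciSup (h x) p)))
  star_mul_self' x := by
    refine le_antisymm (ciSup_le fun p => ?_) ?_
    · rw [p.star_mul_self]
      exact pow_le_pow_left₀ (apply_nonneg p.toSeminorm _) (le_ciSup (h x) p) 2
    · have h0 : 0 ≤ ⨆ p : CStarSeminorm R, p x :=
        Real.iSup_nonneg fun p => apply_nonneg p.toSeminorm _
      have h1 : 0 ≤ ⨆ p : CStarSeminorm R, p (star x * x) :=
        Real.iSup_nonneg fun p => apply_nonneg p.toSeminorm _
      refine (Real.le_sqrt h0 h1).1 (ciSup_le fun p => Real.le_sqrt_of_sq_le ?_)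
      rw [← p.star_mul_self]
      exact le_ciSup (h (star x * x)) p

end CStarSeminorm

/-- A partial action of a discrete group `G` on a unital C*-algebra `A`: closed two-sided ideals
`D g` (as such automatically stable under the involution) and `*`-isomorphisms
`α g : D g⁻¹ ≃ D g` such that `D 1 = A` and `α (h * i)` extends `α h ∘ α i`, where the composition
is defined at the points of `D i⁻¹` which `α i` maps into `D h⁻¹`. -/
structure CStarPartialAction (G : Type*) (A : Type*) [Group G] [CStarAlgebra A] where
  ideal : G → NonUnitalStarSubalgebra ℂ A
  isClosed_ideal : ∀ g, IsClosed (ideal g : Set A)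
  mul_mem_left : ∀ (g : G) (a b : A), b ∈ ideal g → a * b ∈ ideal g
  mul_mem_right : ∀ (g : G) (a b : A), a ∈ ideal g → a * b ∈ ideal g
  equiv : ∀ g, ideal g⁻¹ ≃⋆ₐ[ℂ] ideal g
  ideal_one : ideal 1 = ⊤
  equiv_mul : ∀ (h i : G) (a : ideal i⁻¹) (ha : (equiv i a : A) ∈ ideal h⁻¹),
    ∃ ha' : (a : A) ∈ ideal (h * i)⁻¹,
      (equiv (h * i) ⟨a, ha'⟩ : A) = equiv h ⟨equiv i a, ha⟩

namespace CStarPartialAction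

variable {G A : Type*} [Group G] [CStarAlgebra A] (α : CStarPartialAction G A)

open Classical in
/-- The partial automorphism `α g`, as a function on `A` with value `0` outside its domain. -/
def act (g : G) (a : A) : A := if ha : a ∈ α.ideal g⁻¹ then α.equiv g ⟨a, ha⟩ else 0

variable {α}

theorem act_eq {g : G} {a : A} (ha : a ∈ α.ideal g⁻¹) : α.act g a = α.equiv g ⟨a, ha⟩ :=
  dif_pos ha

theorem act_mem {g : G} {a : A} (ha : a ∈ α.ideal g⁻¹) : α.act g a ∈ α.ideal g := by
  rw [act_eq ha]; exact (α.equiv g ⟨a, ha⟩).2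

theorem act_inv_mem {g : G} {a : A} (ha : a ∈ α.ideal g) : α.act g⁻¹ a ∈ α.ideal g⁻¹ :=
  act_mem (by rwa [inv_inv])

theorem act_add {g : G} {a b : A} (ha : a ∈ α.ideal g⁻¹) (hb : b ∈ α.ideal g⁻¹) :
    α.act g (a + b) = α.act g a + α.act g b := by
  rw [act_eq ha, act_eq hb, act_eq (add_mem ha hb)]
  exact congrArg Subtype.val (map_add (α.equiv g) ⟨a, ha⟩ ⟨b, hb⟩)

theorem act_mul {g : G} {a b : A} (ha : a ∈ α.ideal g⁻¹) (hb : b ∈ α.ideal g⁻¹) :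
    α.act g (a * b) = α.act g a * α.act g b := by
  rw [act_eq ha, act_eq hb, act_eq (mul_mem ha hb)]
  exact congrArg Subtype.val (map_mul (α.equiv g) ⟨a, ha⟩ ⟨b, hb⟩)

theorem act_smul {g : G} {a : A} (c : ℂ) (ha : a ∈ α.ideal g⁻¹) :
    α.act g (c • a) = c • α.act g a := by
  rw [act_eq ha, act_eq (SMulMemClass.smul_mem c ha)]
  exact congrArg Subtype.val (map_smul (α.equiv g) c ⟨a, ha⟩)

theorem act_star {g : G} {a : A} (ha : a ∈ α.ideal g⁻¹) :
    α.act g (star a) = star (α.act g a) := by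
  rw [act_eq ha, act_eq (star_mem ha)]
  exact congrArg Subtype.val (map_star (α.equiv g) ⟨a, ha⟩)

theorem act_comp {h i : G} {a : A} (ha : a ∈ α.ideal i⁻¹) (ha' : α.act i a ∈ α.ideal h⁻¹) :
    a ∈ α.ideal (h * i)⁻¹ ∧ α.act (h * i) a = α.act h (α.act i a) := by
  have ha'' : (α.equiv i ⟨a, ha⟩ : A) ∈ α.ideal h⁻¹ := by rwa [act_eq ha] at ha'
  obtain ⟨h1, h2⟩ := α.equiv_mul h i ⟨a, ha⟩ ha''
  refine ⟨h1, ?_⟩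
  rw [act_eq h1, h2, act_eq ha']
  simp only [act_eq ha]

theorem mem_ideal_one (a : A) : a ∈ α.ideal 1 := by rw [α.ideal_one]; trivial

theorem act_one (a : A) : α.act 1 a = a := by
  have h : ∀ b : A, b ∈ α.ideal (1 : G)⁻¹ := fun b => by rw [inv_one]; exact mem_ideal_one b
  have h1 := (act_comp (h := 1) (i := 1) (h a) (h _)).2
  rw [mul_one, act_eq (h a), act_eq (h _)] at h1
  have h2 := (α.equiv 1).injective (Subtype.ext h1)
  rw [act_eq (h a)]
  exact (congrArg Subtype.val h2).symm

theorem act_inv_act {g : G} {a : A} (ha : a ∈ α.ideal g⁻¹) : α.act g⁻¹ (α.act g a) = a := by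
  have := (act_comp (h := g⁻¹) ha (by rw [inv_inv]; exact act_mem ha)).2
  rw [← this, inv_mul_cancel, act_one]

theorem act_act_inv {g : G} {a : A} (ha : a ∈ α.ideal g) : α.act g (α.act g⁻¹ a) = a := by
  have := act_inv_act (α := α) (g := g⁻¹) (a := a) (by rwa [inv_inv])
  rwa [inv_inv] at this

/-- `α g` maps `D g⁻¹ ∩ D h` into `D (g * h)`, and there `α h⁻¹ = α (g * h)⁻¹ ∘ α g`. -/
theorem act_inter {g h : G} {a : A} (ha : a ∈ α.ideal g⁻¹) (ha' : a ∈ α.ideal h) :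
    α.act g a ∈ α.ideal (g * h) ∧ α.act (g * h)⁻¹ (α.act g a) = α.act h⁻¹ a := by
  have h1 : α.act h⁻¹ a ∈ α.ideal h⁻¹ := act_inv_mem ha'
  have h2 : α.act h (α.act h⁻¹ a) = a := act_act_inv ha'
  obtain ⟨h3, h4⟩ := act_comp (h := g) h1 (by rwa [h2])
  rw [h2] at h4
  rw [← h4]
  exact ⟨act_mem h3, act_inv_act h3⟩

theorem mul_mem_inter {g h : G} {a b : A} (ha : a ∈ α.ideal g) (hb : b ∈ α.ideal h) :
    a * b ∈ α.ideal g ∧ a * b ∈ α.ideal h :=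
  ⟨α.mul_mem_right _ _ _ ha, α.mul_mem_left _ _ _ hb⟩

theorem mul_coeff_mem {g h : G} {a b : A} (ha : a ∈ α.ideal g) (hb : b ∈ α.ideal h) :
    α.act g (α.act g⁻¹ a * b) ∈ α.ideal (g * h) :=
  (act_inter (mul_mem_inter (act_inv_mem ha) hb).1 (mul_mem_inter (act_inv_mem ha) hb).2).1

theorem act_zero (g : G) : α.act g 0 = 0 := by
  rw [act_eq (zero_mem _)]
  exact congrArg Subtype.val (map_zero (α.equiv g))

theorem act_sub {g : G} {a b : A} (ha : a ∈ α.ideal g⁻¹) (hb : b ∈ α.ideal g⁻¹) :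
    α.act g (a - b) = α.act g a - α.act g b := by
  rw [eq_sub_iff_add_eq, ← act_add (sub_mem ha hb) hb, sub_add_cancel]

/-- The multipliers `b ↦ a * b` and `b ↦ α h (α h⁻¹ b * c)` of `D h` commute. -/
theorem act_mul_middle {h : G} (a : A) {b : A} (c : A) (hb : b ∈ α.ideal h) :
    α.act h (α.act h⁻¹ (a * b) * c) = a * α.act h (α.act h⁻¹ b * c) := by
  have hab := α.mul_mem_left h a b hb
  have h1 : ∀ {x : A}, x ∈ α.ideal h → α.act h⁻¹ x * c ∈ α.ideal h⁻¹ := fun hx =>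
    α.mul_mem_right _ _ _ (act_inv_mem hx)
  have key : ∀ d ∈ α.ideal h, d * α.act h (α.act h⁻¹ (a * b) * c)
      = d * (a * α.act h (α.act h⁻¹ b * c)) := by
    intro d hd
    have hd' : d ∈ α.ideal h⁻¹⁻¹ := by rwa [inv_inv]
    have move : ∀ {e x : A}, e ∈ α.ideal h → x ∈ α.ideal h →
        e * α.act h (α.act h⁻¹ x * c) = α.act h (α.act h⁻¹ (e * x) * c) := by
      intro e x he hx
      have he' : e ∈ α.ideal h⁻¹⁻¹ := by rwa [inv_inv]
      have hx' : x ∈ α.ideal h⁻¹⁻¹ := by rwa [inv_inv]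
      rw [act_mul he' hx', mul_assoc, act_mul (act_inv_mem he) (h1 hx), act_act_inv he]
    rw [move hd hab, ← mul_assoc d a, ← mul_assoc, move (α.mul_mem_right _ _ _ hd) hb]
  set x := α.act h (α.act h⁻¹ (a * b) * c)
  set y := a * α.act h (α.act h⁻¹ b * c)
  have hx : x ∈ α.ideal h := act_mem (h1 hab)
  have hy : y ∈ α.ideal h := α.mul_mem_left _ _ _ (act_mem (h1 hb))
  have h2 := key (star (x - y)) (star_mem (sub_mem hx hy))
  rw [← sub_eq_zero, ← mul_sub, CStarRing.star_mul_self_eq_zero_iff] at h2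
  exact sub_eq_zero.1 h2

variable (α)

/-- The product `(a δ_g) (b δ_h) = α_g (α_g⁻¹ (a) b) δ_{gh}` on coefficients. -/
def mulCoeff (g h : G) : α.ideal g →ₗ[ℂ] α.ideal h →ₗ[ℂ] α.ideal (g * h) :=
  LinearMap.mk₂ ℂ (fun a b => ⟨α.act g (α.act g⁻¹ a * b), mul_coeff_mem a.2 b.2⟩)
    (fun a a' b => Subtype.ext <| by
      have ha : (a : A) ∈ α.ideal g⁻¹⁻¹ := by rw [inv_inv]; exact a.2
      have ha' : (a' : A) ∈ α.ideal g⁻¹⁻¹ := by rw [inv_inv]; exact a'.2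
      simp only [AddMemClass.coe_add]
      rw [act_add ha ha', add_mul,
        act_add (α.mul_mem_right _ _ _ (act_mem ha)) (α.mul_mem_right _ _ _ (act_mem ha'))])
    (fun c a b => Subtype.ext <| by
      have ha : (a : A) ∈ α.ideal g⁻¹⁻¹ := by rw [inv_inv]; exact a.2
      simp only [SetLike.val_smul]
      rw [act_smul c ha, smul_mul_assoc, act_smul c (α.mul_mem_right _ _ _ (act_mem ha))])
    (fun a b b' => Subtype.ext <| by
      have ha : (a : A) ∈ α.ideal g⁻¹⁻¹ := by rw [inv_inv]; exact a.2
      simp only [AddMemClass.coe_add]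
      rw [mul_add,
        act_add (α.mul_mem_right _ _ _ (act_mem ha)) (α.mul_mem_right _ _ _ (act_mem ha))])
    (fun c a b => Subtype.ext <| by
      have ha : (a : A) ∈ α.ideal g⁻¹⁻¹ := by rw [inv_inv]; exact a.2
      simp only [SetLike.val_smul]
      rw [mul_smul_comm, act_smul c (α.mul_mem_right _ _ _ (act_mem ha))])

/-- The involution `(a δ_g)* = α_g⁻¹ (a*) δ_{g⁻¹}` on coefficients. -/
def starCoeff (g : G) : α.ideal g →+ α.ideal g⁻¹ where
  toFun a := ⟨α.act g⁻¹ (star a), act_inv_mem (star_mem a.2)⟩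
  map_zero' := Subtype.ext <| by simp [act_zero]
  map_add' a b := Subtype.ext <| by
    have ha : star (a : A) ∈ α.ideal g⁻¹⁻¹ := by rw [inv_inv]; exact star_mem a.2
    have hb : star (b : A) ∈ α.ideal g⁻¹⁻¹ := by rw [inv_inv]; exact star_mem b.2
    simp only [AddMemClass.coe_add, star_add]
    rw [act_add ha hb]

/-- The algebraic crossed product: finite formal sums `∑ a_g δ_g` with `a_g ∈ D g`. -/
def AlgCrossedProduct : Type _ := DirectSum G fun g => α.ideal g

namespace AlgCrossedProduct

open Classical DirectSum

instance : AddCommGroup α.AlgCrossedProduct :=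
  inferInstanceAs (AddCommGroup (DirectSum G fun g => α.ideal g))

instance : Module ℂ α.AlgCrossedProduct :=
  inferInstanceAs (Module ℂ (DirectSum G fun g => α.ideal g))

variable {α}

/-- The element `a δ_g`, for `a ∈ D g`. -/
def single (g : G) (a : A) (ha : a ∈ α.ideal g) : α.AlgCrossedProduct :=
  DirectSum.lof ℂ G (fun g => α.ideal g) g ⟨a, ha⟩

theorem single_congr {g g' : G} {a a' : A} {ha : a ∈ α.ideal g} (hg : g = g') (h : a = a') :
    single g a ha = single g' a' (hg ▸ h ▸ ha) := by
  subst hg h; rfl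

theorem single_add {g : G} {a b : A} (ha : a ∈ α.ideal g) (hb : b ∈ α.ideal g) :
    single g (a + b) (add_mem ha hb) = single g a ha + single g b hb :=
  map_add (DirectSum.lof ℂ G (fun g => α.ideal g) g) ⟨a, ha⟩ ⟨b, hb⟩

theorem smul_single {g : G} {a : A} (c : ℂ) (ha : a ∈ α.ideal g) :
    c • single g a ha = single g (c • a) (SMulMemClass.smul_mem c ha) :=
  (map_smul (DirectSum.lof ℂ G (fun g => α.ideal g) g) c ⟨a, ha⟩).symm

theorem induction {p : α.AlgCrossedProduct → Prop} (zero : p 0)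
    (single : ∀ g a ha, p (single g a ha)) (add : ∀ x y, p x → p y → p (x + y))
    (x : α.AlgCrossedProduct) : p x :=
  DirectSum.induction_on x zero (fun g a => single g a a.2) add

variable (α)

/-- The product of the summands at `g` and `h`, in the algebraic crossed product. -/
def mulAux' (g h : G) : α.ideal g →ₗ[ℂ] α.ideal h →ₗ[ℂ] α.AlgCrossedProduct :=
  (α.mulCoeff g h).compr₂ (DirectSum.lof ℂ G (fun g => α.ideal g) (g * h))

/-- The product of the summand at `g` with an arbitrary element (the latter written first). -/
def mulAux (g : G) : α.AlgCrossedProduct →ₗ[ℂ] α.ideal g →ₗ[ℂ] α.AlgCrossedProduct :=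
  DirectSum.toModule ℂ G _ fun h => (mulAux' α g h).flip

/-- The bilinear extension of the product of the algebraic crossed product. -/
def mulLin : α.AlgCrossedProduct →ₗ[ℂ] α.AlgCrossedProduct →ₗ[ℂ] α.AlgCrossedProduct :=
  DirectSum.toModule ℂ G _ fun g => (mulAux α g).flip

/-- The additive extension of the involution of the algebraic crossed product. -/
def starHom : α.AlgCrossedProduct →+ α.AlgCrossedProduct :=
  DirectSum.toAddMonoid fun g =>
    (DirectSum.of (fun g => α.ideal g) g⁻¹).comp (α.starCoeff g)

instance : Mul α.AlgCrossedProduct := ⟨fun x y => mulLin α x y⟩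

instance : One α.AlgCrossedProduct := ⟨single 1 1 (mem_ideal_one 1)⟩

instance : Star α.AlgCrossedProduct := ⟨starHom α⟩

variable {α}

theorem mul_def (x y : α.AlgCrossedProduct) : x * y = mulLin α x y := rfl

theorem one_def : (1 : α.AlgCrossedProduct) = single 1 1 (mem_ideal_one 1) := rfl

theorem star_def (x : α.AlgCrossedProduct) : star x = starHom α x := rfl

theorem single_mul_single {g h : G} {a b : A} (ha : a ∈ α.ideal g) (hb : b ∈ α.ideal h) :
    single g a ha * single h b hb
      = single (g * h) (α.act g (α.act g⁻¹ a * b)) (mul_coeff_mem ha hb) := by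
  have h1 : mulLin α (single g a ha) = (mulAux α g).flip ⟨a, ha⟩ :=
    DirectSum.toModule_lof (M := fun g => α.ideal g)
      (φ := fun g => (mulAux α g).flip) ℂ g ⟨a, ha⟩
  have h2 : mulAux α g (single h b hb) = (mulAux' α g h).flip ⟨b, hb⟩ :=
    DirectSum.toModule_lof (M := fun g => α.ideal g)
      (φ := fun h => (mulAux' α g h).flip) ℂ h ⟨b, hb⟩
  rw [mul_def, h1, LinearMap.flip_apply, h2]
  rfl

theorem star_single {g : G} {a : A} (ha : a ∈ α.ideal g) :
    star (single g a ha) = single g⁻¹ (α.act g⁻¹ (star a)) (act_inv_mem (star_mem ha)) := by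
  exact DirectSum.toAddMonoid_of (β := fun g => α.ideal g) _ g ⟨a, ha⟩

instance : Ring α.AlgCrossedProduct where
  __ := (inferInstance : AddCommGroup α.AlgCrossedProduct)
  left_distrib x y z := map_add (mulLin α x) y z
  right_distrib x y z := by simp only [mul_def, map_add, LinearMap.add_apply]
  zero_mul x := by simp only [mul_def, map_zero, LinearMap.zero_apply]
  mul_zero x := map_zero (mulLin α x)
  mul_assoc x y z := by
    induction x using induction with
    | zero => simp only [mul_def, map_zero, LinearMap.zero_apply]
    | add x x' hx hx' => simp only [mul_def, map_add, LinearMap.add_apply] at *; rw [hx, hx']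
    | single g a ha =>
    induction y using induction with
    | zero => simp only [mul_def, map_zero, LinearMap.zero_apply]
    | add x x' hx hx' => simp only [mul_def, map_add, LinearMap.add_apply] at *; rw [hx, hx']
    | single h b hb =>
    induction z using induction with
    | zero => simp only [mul_def, map_zero]
    | add x x' hx hx' => simp only [mul_def, map_add] at *; rw [hx, hx']
    | single k c hc =>
      simp only [single_mul_single]
      have h1 := mul_mem_inter (act_inv_mem ha) hb
      obtain ⟨h2, h3⟩ := act_inter h1.1 h1.2
      refine single_congr (mul_assoc g h k) ?_
      rw [h3, ← act_mul_middle _ _ hb]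
      have h4 := mul_mem_inter (act_inv_mem h1.2) hc
      refine (act_comp h4.1 ?_).2
      rw [act_mul_middle _ _ hb]
      exact α.mul_mem_right _ _ _ (act_inv_mem ha)
  one_mul x := by
    induction x using induction with
    | zero => simp only [mul_def, map_zero]
    | add x x' hx hx' => simp only [mul_def, map_add] at *; rw [hx, hx']
    | single g a ha =>
      rw [one_def, single_mul_single]
      exact single_congr (one_mul g) (by rw [inv_one, act_one, act_one, one_mul])
  mul_one x := by
    induction x using induction with
    | zero => simp only [mul_def, map_zero, LinearMap.zero_apply]
    | add x x' hx hx' => simp only [mul_def, map_add, LinearMap.add_apply] at *; rw [hx, hx']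
    | single g a ha =>
      rw [one_def, single_mul_single]
      exact single_congr (mul_one g) (by rw [mul_one, act_act_inv ha])

instance : Algebra ℂ α.AlgCrossedProduct :=
  Algebra.ofModule
    (fun c x y => by simp only [mul_def, map_smul, LinearMap.smul_apply])
    (fun c x y => by simp only [mul_def, map_smul])

instance : StarRing α.AlgCrossedProduct where
  star_add x y := map_add (starHom α) x y
  star_involutive x := by
    induction x using induction with
    | zero => simp only [star_def, map_zero]
    | add x x' hx hx' => simp only [star_def, map_add] at *; rw [hx, hx']
    | single g a ha =>
      rw [star_single, star_single]
      refine single_congr (inv_inv g) ?_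
      have ha' : star a ∈ α.ideal g⁻¹⁻¹ := by rw [inv_inv]; exact star_mem ha
      have ha'' : a ∈ α.ideal g⁻¹⁻¹ := by rw [inv_inv]; exact ha
      rw [act_star ha'', star_star, inv_inv, act_act_inv ha]
  star_mul x y := by
    induction x using induction with
    | zero => simp only [star_def, mul_def, map_zero, LinearMap.zero_apply]
    | add x x' hx hx' =>
      simp only [star_def, mul_def, map_add, LinearMap.add_apply] at *; rw [hx, hx']
    | single g a ha =>
    induction y using induction with
    | zero => simp only [star_def, mul_def, map_zero, LinearMap.zero_apply]
    | add x x' hx hx' =>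
      simp only [star_def, mul_def, map_add, LinearMap.add_apply] at *; rw [hx, hx']
    | single h b hb =>
      rw [single_mul_single, star_single, star_single, star_single, single_mul_single]
      refine single_congr (mul_inv_rev g h) ?_
      have ha' : a ∈ α.ideal g⁻¹⁻¹ := by rw [inv_inv]; exact ha
      have hb' : b ∈ α.ideal h⁻¹⁻¹ := by rw [inv_inv]; exact hb
      obtain ⟨h1, h2⟩ := mul_mem_inter (act_inv_mem ha) hb
      rw [inv_inv, act_act_inv (star_mem hb), act_star ha', ← star_mul, ← act_star h1]
      exact (act_inter (star_mem h1) (star_mem h2)).2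

instance : StarModule ℂ α.AlgCrossedProduct where
  star_smul c x := by
    induction x using induction with
    | zero => simp only [star_def, map_zero, smul_zero]
    | add x x' hx hx' => simp only [smul_add, star_add, hx, hx']
    | single g a ha =>
      have ha' : star a ∈ α.ideal g⁻¹⁻¹ := by rw [inv_inv]; exact star_mem ha
      rw [smul_single, star_single, star_single, smul_single]
      exact single_congr rfl (by rw [star_smul, act_smul _ ha'])

/-- The copy `a ↦ a δ_1` of the coefficient algebra. -/
def coeff (α : CStarPartialAction G A) : A →⋆ₐ[ℂ] α.AlgCrossedProduct where
  toFun a := single 1 a (mem_ideal_one a)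
  map_one' := rfl
  map_mul' a b := by
    rw [single_mul_single]
    exact single_congr (mul_one 1).symm (by rw [act_one, inv_one, act_one])
  map_zero' := map_zero (DirectSum.lof ℂ G (fun g => α.ideal g) 1)
  map_add' a b := single_add _ _
  commutes' c := by
    rw [Algebra.algebraMap_eq_smul_one, Algebra.algebraMap_eq_smul_one, one_def, smul_single]
  map_star' a := by
    rw [star_single]
    exact single_congr inv_one.symm (by rw [inv_one, act_one])

theorem bddAbove_seminorm (x : α.AlgCrossedProduct) :
    BddAbove (Set.range fun p : CStarSeminorm α.AlgCrossedProduct => p x) := by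
  induction x using induction with
  | zero => exact ⟨0, by rintro _ ⟨p, rfl⟩; exact (map_zero p.toSeminorm).le⟩
  | add x y hx hy =>
    obtain ⟨c, hc⟩ := hx
    obtain ⟨d, hd⟩ := hy
    refine ⟨c + d, ?_⟩
    rintro _ ⟨p, rfl⟩
    exact (map_add_le_add p.toSeminorm x y).trans (add_le_add (hc ⟨p, rfl⟩) (hd ⟨p, rfl⟩))
  | single g a ha =>
    refine ⟨Real.sqrt ‖α.act g⁻¹ (star a * a)‖, ?_⟩
    rintro _ ⟨p, rfl⟩
    refine Real.le_sqrt_of_sq_le ?_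
    rw [← p.star_mul_self]
    refine le_trans (le_of_eq ?_) ((p.comap (coeff α)).le_norm _)
    rw [CStarSeminorm.comap_apply]
    congr 1
    rw [star_single, single_mul_single]
    have ha' : a ∈ α.ideal g⁻¹⁻¹ := by rw [inv_inv]; exact ha
    refine single_congr (inv_mul_cancel g) ?_
    rw [inv_inv, act_act_inv (star_mem ha)]

end AlgCrossedProduct

/-- The greatest C*-seminorm on the algebraic crossed product. -/
def maxSeminorm : CStarSeminorm α.AlgCrossedProduct :=
  CStarSeminorm.sup AlgCrossedProduct.bddAbove_seminorm

/-- The (full) partial crossed product of `A` by `G`: the enveloping C*-algebra of the algebraic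
crossed product, i.e. its completion with respect to the greatest C*-seminorm. -/
abbrev CrossedProduct : Type _ := α.maxSeminorm.Completion

end CStarPartialAction

/-- A partial action of a group `G` on a set `X`: subsets `D g` and bijections
`θ g : D g⁻¹ ≃ D g` with `D 1 = X`, `θ 1 = id`, `θ h (D i) = D h ∩ D (h * i)` (where
`θ h (D i)` means `θ h (D h⁻¹ ∩ D i)`) and `θ h (θ i x) = θ (h * i) x` for
`x ∈ D i⁻¹ ∩ D (i⁻¹ * h⁻¹)`. In the last condition the memberships `hθ` and `hx'` needed to write
down both sides follow from the other conditions. -/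
structure PartialAction (G : Type*) (X : Type*) [Group G] where
  dom : G → Set X
  map : ∀ g, dom g⁻¹ ≃ dom g
  dom_one : dom 1 = Set.univ
  map_one : ∀ x : dom (1 : G)⁻¹, (map 1 x : X) = x
  image_dom : ∀ h i : G,
    {y : X | ∃ x : dom h⁻¹, (x : X) ∈ dom i ∧ (map h x : X) = y} = dom h ∩ dom (h * i)
  map_mul : ∀ (h i : G) (x : X) (hx : x ∈ dom i⁻¹), x ∈ dom (i⁻¹ * h⁻¹) →
    ∀ (hθ : (map i ⟨x, hx⟩ : X) ∈ dom h⁻¹) (hx' : x ∈ dom (h * i)⁻¹),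
      (map h ⟨map i ⟨x, hx⟩, hθ⟩ : X) = map (h * i) ⟨x, hx'⟩

/-- A map between Boolean algebras which preserves intersections, unions and complements. -/
structure IsBooleanHom {B B' : Type*} [BooleanAlgebra B] [BooleanAlgebra B'] (φ : B → B') :
    Prop where
  map_inf : ∀ a b, φ (a ⊓ b) = φ a ⊓ φ b
  map_sup : ∀ a b, φ (a ⊔ b) = φ a ⊔ φ b
  map_compl : ∀ a, φ aᶜ = (φ a)ᶜ

namespace PartialAction

variable {G X : Type*} [Group G] (θ : PartialAction G X)

variable {θ} in
theorem mem_dom_inv_mul {h i : G} {x : X} (hx : x ∈ θ.dom i⁻¹)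
    (hθ : (θ.map i ⟨x, hx⟩ : X) ∈ θ.dom h⁻¹) : x ∈ θ.dom (i⁻¹ * h⁻¹) := by
  have h1 : (θ.map i ⟨x, hx⟩ : X) ∈ θ.dom i ∩ θ.dom (i * (i⁻¹ * h⁻¹)) :=
    ⟨(θ.map i ⟨x, hx⟩).2, by rwa [mul_inv_cancel_left]⟩
  rw [← θ.image_dom] at h1
  obtain ⟨z, hz, hz'⟩ := h1
  have := (θ.map i).injective (Subtype.ext hz')
  rwa [this] at hz

variable {θ} in
theorem map_mem_dom_inv {h i : G} {x : X} (hx : x ∈ θ.dom i⁻¹) (hx' : x ∈ θ.dom (i⁻¹ * h⁻¹)) :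
    (θ.map i ⟨x, hx⟩ : X) ∈ θ.dom h⁻¹ := by
  have h1 : (θ.map i ⟨x, hx⟩ : X) ∈ θ.dom i ∩ θ.dom (i * (i⁻¹ * h⁻¹)) := by
    rw [← θ.image_dom]
    exact ⟨⟨x, hx⟩, hx', rfl⟩
  rw [mul_inv_cancel_left] at h1
  exact h1.2

variable {θ} in
/-- `θ g⁻¹` is the inverse of `θ g`. -/
theorem map_inv_map {g : G} (x : θ.dom g⁻¹) (hx : (θ.map g x : X) ∈ θ.dom g⁻¹⁻¹) :
    (θ.map g⁻¹ ⟨θ.map g x, hx⟩ : X) = x := by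
  have h1 : ∀ k : G, k = 1 → ∀ (y : X) (hy : y ∈ θ.dom k⁻¹), (θ.map k ⟨y, hy⟩ : X) = y := by
    rintro _ rfl y hy
    exact θ.map_one ⟨y, hy⟩
  have h2 : (x : X) ∈ θ.dom (g⁻¹ * g)⁻¹ := by
    rw [inv_mul_cancel, inv_one, θ.dom_one]; trivial
  rw [θ.map_mul g⁻¹ g x x.2 (by rwa [mul_inv_rev] at h2) hx h2]
  exact h1 _ (inv_mul_cancel g) _ _

variable {θ} in
theorem map_inv_eq_symm {g : G} (y : θ.dom g) (hy : (y : X) ∈ θ.dom g⁻¹⁻¹) :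
    (θ.map g⁻¹ ⟨y, hy⟩ : X) = (θ.map g).symm y := by
  have h := map_inv_map ((θ.map g).symm y) (by rwa [Equiv.apply_symm_apply])
  simpa only [Equiv.apply_symm_apply] using h

/-- The preimage `θ_g⁻¹(A) = {x ∈ D g⁻¹ | θ g x ∈ A}`. -/
def preimage (g : G) (A : Set X) : Set X :=
  {x | ∃ hx : x ∈ θ.dom g⁻¹, (θ.map g ⟨x, hx⟩ : X) ∈ A}

theorem preimage_inter (g : G) (A B : Set X) :
    θ.preimage g (A ∩ B) = θ.preimage g A ∩ θ.preimage g B := by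
  ext x; constructor
  · rintro ⟨hx, h1, h2⟩; exact ⟨⟨hx, h1⟩, ⟨hx, h2⟩⟩
  · rintro ⟨⟨hx, h1⟩, ⟨_, h2⟩⟩; exact ⟨hx, h1, h2⟩

theorem preimage_union (g : G) (A B : Set X) :
    θ.preimage g (A ∪ B) = θ.preimage g A ∪ θ.preimage g B := by
  ext x; constructor
  · rintro ⟨hx, h1 | h1⟩
    · exact Or.inl ⟨hx, h1⟩
    · exact Or.inr ⟨hx, h1⟩
  · rintro (⟨hx, h1⟩ | ⟨hx, h1⟩)
    · exact ⟨hx, Or.inl h1⟩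
    · exact ⟨hx, Or.inr h1⟩

theorem preimage_compl (g : G) (A : Set X) :
    θ.preimage g Aᶜ = θ.dom g⁻¹ ∩ (θ.preimage g A)ᶜ := by
  ext x; constructor
  · rintro ⟨hx, h1⟩; exact ⟨hx, fun ⟨_, h2⟩ => h1 h2⟩
  · rintro ⟨hx, h1⟩; exact ⟨hx, fun h2 => h1 ⟨hx, h2⟩⟩

theorem preimage_dom (g i : G) :
    θ.preimage g (θ.dom i) = θ.dom g⁻¹ ∩ θ.dom (g⁻¹ * i) := by
  ext x; constructor
  · rintro ⟨hx, h1⟩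
    refine ⟨hx, ?_⟩
    rw [← inv_inv i] at h1
    simpa using mem_dom_inv_mul hx h1
  · rintro ⟨hx, h1⟩
    refine ⟨hx, ?_⟩
    rw [← inv_inv i] at h1
    simpa using map_mem_dom_inv hx h1

theorem preimage_dom_self (g : G) : θ.preimage g (θ.dom g) = θ.dom g⁻¹ := by
  rw [preimage_dom, inv_mul_cancel, θ.dom_one, Set.inter_univ]

theorem preimage_one (A : Set X) : θ.preimage 1 A = A := by
  ext x; constructor
  · rintro ⟨hx, h1⟩; rwa [θ.map_one] at h1
  · intro hx
    refine ⟨by rw [inv_one, θ.dom_one]; trivial, ?_⟩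
    rwa [θ.map_one]

theorem preimage_preimage (h i : G) (A : Set X) :
    θ.preimage i (θ.preimage h A) = θ.dom i⁻¹ ∩ θ.preimage (h * i) A := by
  ext x; constructor
  · rintro ⟨hx, hθ, h1⟩
    have h2 := mem_dom_inv_mul hx hθ
    have h3 : x ∈ θ.dom (h * i)⁻¹ := by rwa [mul_inv_rev]
    exact ⟨hx, h3, by rwa [← θ.map_mul h i x hx h2 hθ h3]⟩
  · rintro ⟨hx, h3, h1⟩
    have h2 : x ∈ θ.dom (i⁻¹ * h⁻¹) := by rwa [← mul_inv_rev]
    have hθ := map_mem_dom_inv hx h2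
    exact ⟨hx, hθ, by rwa [θ.map_mul h i x hx h2 hθ h3]⟩

/-- The Boolean algebra of subsets of `X` generated by the domains. -/
def boolAlg : BooleanSubalgebra (Set X) := BooleanSubalgebra.closure (Set.range θ.dom)

theorem dom_mem (g : G) : θ.dom g ∈ θ.boolAlg :=
  BooleanSubalgebra.subset_closure ⟨g, rfl⟩

theorem preimage_mem (g : G) {A : Set X} (hA : A ∈ θ.boolAlg) :
    θ.preimage g A ∈ θ.boolAlg := by
  refine BooleanSubalgebra.closure_bot_sup_induction
    (p := fun A _ => θ.preimage g A ∈ θ.boolAlg) ?_ ?_ ?_ ?_ hA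
  · rintro _ ⟨i, rfl⟩
    rw [preimage_dom]
    exact BooleanSubalgebra.inf_mem (θ.dom_mem _) (θ.dom_mem _)
  · have : θ.preimage g ⊥ = ⊥ := by
      ext x; exact ⟨fun ⟨_, h⟩ => h, fun h => h.elim⟩
    rw [this]
    exact BooleanSubalgebra.bot_mem
  · intro A _ B _ h1 h2
    exact (θ.preimage_union g A B) ▸ BooleanSubalgebra.sup_mem h1 h2
  · intro A _ h1
    rw [preimage_compl]
    exact BooleanSubalgebra.inf_mem (θ.dom_mem _) (BooleanSubalgebra.compl_mem h1)

/-- The domain `D g`, as an element of the Boolean algebra generated by the domains. -/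
def domB (g : G) : θ.boolAlg := ⟨θ.dom g, θ.dom_mem g⟩

/-- The preimage `θ_g⁻¹(A)`, as an element of the Boolean algebra generated by the domains. -/
def preimageB (g : G) (A : θ.boolAlg) : θ.boolAlg := ⟨θ.preimage g A, θ.preimage_mem g A.2⟩

/-- The dual (Stone) space of the Boolean algebra generated by the domains: all its Boolean
homomorphisms to `{0, 1}`, with the topology of pointwise convergence. -/
def Dual : Type _ := {φ : θ.boolAlg → Bool // IsBooleanHom φ}

namespace Dual

instance : TopologicalSpace θ.Dual :=
  inferInstanceAs (TopologicalSpace {φ : θ.boolAlg → Bool // IsBooleanHom φ})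

theorem continuous_eval (A : θ.boolAlg) : Continuous fun φ : θ.Dual => φ.1 A :=
  (continuous_apply A).comp continuous_subtype_val

instance : CompactSpace θ.Dual := by
  refine isCompact_iff_compactSpace.1 (IsClosed.isCompact (X := θ.boolAlg → Bool) ?_)
  have h : {φ : θ.boolAlg → Bool | IsBooleanHom φ} =
      (⋂ (a) (b), {φ | φ (a ⊓ b) = φ a ⊓ φ b}) ∩ (⋂ (a) (b), {φ | φ (a ⊔ b) = φ a ⊔ φ b}) ∩
        ⋂ a, {φ | φ aᶜ = (φ a)ᶜ} := by
    ext φ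
    simp only [Set.mem_inter_iff, Set.mem_iInter, Set.mem_ofPred_eq]
    exact ⟨fun h => ⟨⟨h.1, h.2⟩, h.3⟩, fun h => ⟨h.1.1, h.1.2, h.2⟩⟩
  have h2 : ∀ f : Bool × Bool → Bool, Continuous f := fun f => continuous_of_discreteTopology
  have h1 : ∀ f : Bool → Bool, Continuous f := fun f => continuous_of_discreteTopology
  change IsClosed {φ : θ.boolAlg → Bool | IsBooleanHom φ}
  rw [h]
  refine ((isClosed_iInter fun a => isClosed_iInter fun b => ?_).inter
    (isClosed_iInter fun a => isClosed_iInter fun b => ?_)).inter (isClosed_iInter fun a => ?_)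
  · exact isClosed_eq (continuous_apply _)
      ((h2 fun p => p.1 ⊓ p.2).comp (f := fun φ : θ.boolAlg → Bool => (φ a, φ b))
        ((continuous_apply a).prodMk (continuous_apply b)))
  · exact isClosed_eq (continuous_apply _)
      ((h2 fun p => p.1 ⊔ p.2).comp (f := fun φ : θ.boolAlg → Bool => (φ a, φ b))
        ((continuous_apply a).prodMk (continuous_apply b)))
  · exact isClosed_eq (continuous_apply _) ((h1 fun p => pᶜ).comp (continuous_apply a))

variable {θ}

theorem map_top (φ : θ.Dual) : φ.1 ⊤ = true := by
  have h1 := φ.2.map_sup ⊤ ⊤ᶜ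
  rw [φ.2.map_compl, sup_compl_eq_top, sup_compl_eq_top] at h1
  exact h1

theorem map_inf_eq_true (φ : θ.Dual) (A B : θ.boolAlg) :
    φ.1 (A ⊓ B) = true ↔ φ.1 A = true ∧ φ.1 B = true := by
  rw [φ.2.map_inf]; exact Bool.and_eq_true_iff

variable (θ)

/-- The clopen set `{φ | φ (D g) = 1}` of the dual space. -/
def dom (g : G) : Set θ.Dual := {φ | φ.1 (θ.domB g) = true}

variable {θ}

theorem map_inf_of_mem {g : G} {φ : θ.Dual} (hφ : φ ∈ dom θ g) (A : θ.boolAlg) :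
    φ.1 (θ.domB g ⊓ A) = φ.1 A := by
  rw [φ.2.map_inf, show φ.1 (θ.domB g) = ⊤ from hφ, top_inf_eq]

/-- The homomorphism `A ↦ φ (θ_g⁻¹(A))`, for `φ` with `φ (D g⁻¹) = 1`. -/
def mapFun (g : G) (φ : dom θ g⁻¹) : θ.Dual :=
  ⟨fun A => φ.1.1 (θ.preimageB g A),
    { map_inf := fun a b => by
        rw [← φ.1.2.map_inf]
        exact congrArg φ.1.1 (Subtype.ext (θ.preimage_inter g a b))
      map_sup := fun a b => by
        rw [← φ.1.2.map_sup]
        exact congrArg φ.1.1 (Subtype.ext (θ.preimage_union g a b))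
      map_compl := fun a => by
        rw [← φ.1.2.map_compl, ← map_inf_of_mem φ.2 (θ.preimageB g a)ᶜ]
        exact congrArg φ.1.1 (Subtype.ext (θ.preimage_compl g a)) }⟩

theorem mapFun_apply (g : G) (φ : dom θ g⁻¹) (A : θ.boolAlg) :
    (mapFun g φ).1 A = φ.1.1 (θ.preimageB g A) := rfl

theorem mapFun_mem (g : G) (φ : dom θ g⁻¹) : mapFun g φ ∈ dom θ g :=
  (congrArg φ.1.1 (Subtype.ext (θ.preimage_dom_self g))).trans φ.2

theorem mapFun_mapFun (h i : G) (φ : dom θ i⁻¹) (h1 : mapFun i φ ∈ dom θ h⁻¹)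
    (h2 : φ.1 ∈ dom θ (h * i)⁻¹) : mapFun h ⟨mapFun i φ, h1⟩ = mapFun (h * i) ⟨φ.1, h2⟩ := by
  refine Subtype.ext (funext fun A => ?_)
  rw [mapFun_apply, mapFun_apply, mapFun_apply, ← map_inf_of_mem φ.2 (θ.preimageB (h * i) A)]
  exact congrArg φ.1.1 (Subtype.ext (θ.preimage_preimage h i A))

theorem mem_dom_one (φ : θ.Dual) : φ ∈ dom θ 1 :=
  (congrArg φ.1 (Subtype.ext θ.dom_one)).trans (map_top φ)

theorem mapFun_of_eq_one {g : G} (hg : g = 1) (φ : dom θ g⁻¹) : mapFun g φ = φ := by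
  subst hg
  exact Subtype.ext (funext fun A => congrArg φ.1.1 (Subtype.ext (θ.preimage_one A)))

theorem mapFun_inv_mapFun (g : G) (φ : dom θ g⁻¹) (h : mapFun g φ ∈ dom θ g⁻¹⁻¹) :
    mapFun g⁻¹ ⟨mapFun g φ, h⟩ = φ := by
  rw [mapFun_mapFun g⁻¹ g φ h (by rw [inv_mul_cancel, inv_one]; exact mem_dom_one _)]
  exact mapFun_of_eq_one (inv_mul_cancel g) _

theorem mapFun_mapFun_inv (g : G) (ψ : dom θ g) (h : ψ.1 ∈ dom θ g⁻¹⁻¹)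
    (h' : mapFun g⁻¹ ⟨ψ.1, h⟩ ∈ dom θ g⁻¹) : mapFun g ⟨mapFun g⁻¹ ⟨ψ.1, h⟩, h'⟩ = ψ := by
  rw [mapFun_mapFun g g⁻¹ ⟨ψ.1, h⟩ h' (by rw [mul_inv_cancel, inv_one]; exact mem_dom_one _)]
  exact mapFun_of_eq_one (mul_inv_cancel g) _

theorem mem_dom_inv_inv {g : G} {φ : θ.Dual} (h : φ ∈ dom θ g) : φ ∈ dom θ g⁻¹⁻¹ := by
  rwa [inv_inv]

theorem mapFun_mem_dom (h i : G) (φ : dom θ h⁻¹) :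
    mapFun h φ ∈ dom θ i ↔ φ.1 ∈ dom θ (h⁻¹ * i) := by
  have : (mapFun h φ).1 (θ.domB i) = φ.1.1 (θ.domB (h⁻¹ * i)) := by
    rw [mapFun_apply, ← map_inf_of_mem φ.2 (θ.domB (h⁻¹ * i))]
    exact congrArg φ.1.1 (Subtype.ext (θ.preimage_dom h i))
  exact (congrArg (· = true) this).to_iff

end Dual

/-- The partial action of `G` on the dual space, `(θ_g φ)(A) = φ (θ_g⁻¹(A))` for
`φ (D g⁻¹) = 1`. -/
def dualAction : PartialAction G θ.Dual where
  dom := Dual.dom θ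
  map g :=
    { toFun φ := ⟨Dual.mapFun g φ, Dual.mapFun_mem g φ⟩
      invFun ψ := ⟨Dual.mapFun g⁻¹ ⟨ψ.1, Dual.mem_dom_inv_inv ψ.2⟩, Dual.mapFun_mem _ _⟩
      left_inv φ := Subtype.ext (Dual.mapFun_inv_mapFun g φ _)
      right_inv ψ := Subtype.ext (Dual.mapFun_mapFun_inv g ψ _ _) }
  dom_one := Set.eq_univ_of_forall Dual.mem_dom_one
  map_one φ := Dual.mapFun_of_eq_one rfl φ
  image_dom h i := by
    ext ψ; constructor
    · rintro ⟨φ, hφ, rfl⟩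
      refine ⟨Dual.mapFun_mem h φ, ?_⟩
      exact (Dual.mapFun_mem_dom h (h * i) φ).2 (by rwa [inv_mul_cancel_left])
    · rintro ⟨h1, h2⟩
      refine ⟨⟨Dual.mapFun h⁻¹ ⟨ψ, Dual.mem_dom_inv_inv h1⟩, Dual.mapFun_mem _ _⟩, ?_,
        Dual.mapFun_mapFun_inv h ⟨ψ, h1⟩ _ _⟩
      refine (Dual.mapFun_mem_dom h⁻¹ i _).2 ?_
      simpa only [inv_inv] using h2
  map_mul h i φ hφ _ h1 h2 := Dual.mapFun_mapFun h i ⟨φ, hφ⟩ h1 h2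

/-- The domains of `θ` are clopen and its partial maps are homeomorphisms. -/
structure IsClopenAction {Y : Type*} [TopologicalSpace Y] (θ : PartialAction G Y) : Prop where
  isClopen_dom : ∀ g, IsClopen (θ.dom g)
  continuous_map : ∀ g, Continuous (θ.map g)
  continuous_symm : ∀ g, Continuous (θ.map g).symm

theorem isClopenAction_dualAction : θ.dualAction.IsClopenAction := by
  have h : ∀ (g : G) (S : Set θ.Dual) (f : S → Dual.dom θ g⁻¹), Continuous f →
      Continuous fun x => Dual.mapFun g (f x) := fun g S f hf =>
    Continuous.subtype_mk (continuous_pi fun A =>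
      (Dual.continuous_eval θ (θ.preimageB g A)).comp (continuous_subtype_val.comp hf)) _
  refine ⟨fun g => ?_, fun g => ?_, fun g => ?_⟩
  · exact (isClopen_discrete {true}).preimage (Dual.continuous_eval θ (θ.domB g))
  · exact (h g _ id continuous_id).subtype_mk _
  · exact (h g⁻¹ _ _ (continuous_subtype_val.subtype_mk _)).subtype_mk _

section Functions

variable {Y : Type*} [TopologicalSpace Y]

/-- The functions in `C(Y)` which vanish off `U`. -/
def vanishingOff (U : Set Y) : NonUnitalStarSubalgebra ℂ C(Y, ℂ) where
  carrier := {f | ∀ y, y ∉ U → f y = 0}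
  add_mem' hf hg y hy := by simp [hf y hy, hg y hy]
  zero_mem' y hy := rfl
  mul_mem' hf hg y hy := by simp [hf y hy]
  smul_mem' c f hf y hy := by simp [hf y hy]
  star_mem' hf y hy := by simp [hf y hy]

open Classical in
/-- The function `f ∘ θ_g⁻¹` on `D g`, extended by `0`. -/
def pushFun {U V : Set Y} (e : U ≃ V) (f : Y → ℂ) (y : Y) : ℂ :=
  if hy : y ∈ V then f (e.symm ⟨y, hy⟩) else 0

theorem pushFun_of_mem {U V : Set Y} (e : U ≃ V) (f : Y → ℂ) {y : Y} (hy : y ∈ V) :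
    pushFun e f y = f (e.symm ⟨y, hy⟩) := dif_pos hy

theorem pushFun_of_notMem {U V : Set Y} (e : U ≃ V) (f : Y → ℂ) {y : Y} (hy : y ∉ V) :
    pushFun e f y = 0 := dif_neg hy

theorem continuous_pushFun {U V : Set Y} (e : U ≃ V) (hV : IsClopen V) (he : Continuous e.symm)
    (f : C(Y, ℂ)) : Continuous (pushFun e f) := by
  rw [continuous_iff_continuousAt]
  intro y
  by_cases hy : y ∈ V
  · rw [← hV.isOpen.isOpenEmbedding_subtypeVal.continuousAt_iff (x := ⟨y, hy⟩)]
    have : pushFun e f ∘ Subtype.val = fun v : V => f (e.symm v) :=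
      funext fun v => pushFun_of_mem e f v.2
    rw [this]
    exact (f.continuous.comp (continuous_subtype_val.comp he)).continuousAt
  · refine (continuousAt_const (y := (0 : ℂ))).congr ?_
    filter_upwards [hV.compl.isOpen.mem_nhds hy] with z hz
    exact (pushFun_of_notMem e f hz).symm

/-- `pushFun` as a map between ideals of `C(Y)`. -/
def push {U V : Set Y} (e : U ≃ V) (hV : IsClopen V) (he : Continuous e.symm)
    (f : vanishingOff U) : vanishingOff V :=
  ⟨⟨pushFun e f.1, continuous_pushFun e hV he f.1⟩, fun _ hy => pushFun_of_notMem e f.1 hy⟩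

theorem push_apply {U V : Set Y} (e : U ≃ V) (hV : IsClopen V) (he : Continuous e.symm)
    (f : vanishingOff U) (v : V) : (push e hV he f).1 v = f.1 (e.symm v) :=
  pushFun_of_mem e f.1 v.2

theorem ext_vanishingOff {U : Set Y} {f g : vanishingOff U}
    (h : ∀ u : U, f.1 u = g.1 u) : f = g := by
  refine Subtype.ext (ContinuousMap.ext fun y => ?_)
  by_cases hy : y ∈ U
  · exact h ⟨y, hy⟩
  · rw [f.2 y hy, g.2 y hy]

/-- The isomorphism `f ↦ f ∘ θ_g⁻¹` between ideals of `C(Y)`. -/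
def pushEquiv {U V : Set Y} (e : U ≃ V) (hU : IsClopen U) (hV : IsClopen V) (he : Continuous e)
    (he' : Continuous e.symm) : vanishingOff U ≃⋆ₐ[ℂ] vanishingOff V where
  toFun := push e hV he'
  invFun := push e.symm hU he
  left_inv f := ext_vanishingOff fun u => by rw [push_apply, push_apply]; simp
  right_inv f := ext_vanishingOff fun u => by rw [push_apply, push_apply]; simp
  map_mul' f g := ext_vanishingOff fun u => by
    rw [push_apply]; exact (congrArg₂ (· * ·) (push_apply ..) (push_apply ..)).symm
  map_add' f g := ext_vanishingOff fun u => by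
    rw [push_apply]; exact (congrArg₂ (· + ·) (push_apply ..) (push_apply ..)).symm
  map_star' f := ext_vanishingOff fun u => by
    rw [push_apply]; exact (congrArg star (push_apply ..)).symm
  map_smul' c f := ext_vanishingOff fun u => by
    rw [push_apply]; exact (congrArg (c • ·) (push_apply ..)).symm

/-- The partial action on the C*-algebra `C(Y)` induced by a partial action on a compact space `Y`
by homeomorphisms between clopen sets: the ideals are
`{f | f = 0 off D g}`, and `f` is sent to `f ∘ θ_{g⁻¹}` on `D g` and `0` off `D g` (recall that
`θ_{g⁻¹}` is the inverse of `θ_g`). -/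
def IsClopenAction.toCStar [CompactSpace Y] {θ : PartialAction G Y} (hθ : θ.IsClopenAction) :
    CStarPartialAction G C(Y, ℂ) where
  ideal g := vanishingOff (θ.dom g)
  isClosed_ideal g := by
    have : ((vanishingOff (θ.dom g) : NonUnitalStarSubalgebra ℂ C(Y, ℂ)) : Set C(Y, ℂ)) =
        ⋂ (y) (_ : y ∉ θ.dom g), {f | f y = 0} := by
      ext f
      simp only [Set.mem_iInter]
      exact Iff.rfl
    rw [this]
    exact isClosed_iInter fun y => isClosed_iInter fun _ =>
      isClosed_eq (continuous_eval_const y) continuous_const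
  mul_mem_left g a b hb y hy := by simp [hb y hy]
  mul_mem_right g a b ha y hy := by simp [ha y hy]
  equiv g := pushEquiv (θ.map g) (hθ.isClopen_dom _) (hθ.isClopen_dom _) (hθ.continuous_map g)
    (hθ.continuous_symm g)
  ideal_one := by
    refine eq_top_iff.2 fun f _ y hy => (hy ?_).elim
    rw [θ.dom_one]; trivial
  equiv_mul h i a ha := by
    have ev : ∀ (g : G) (f : vanishingOff (θ.dom g⁻¹)) (x : θ.dom g⁻¹),
        ((pushEquiv (θ.map g) (hθ.isClopen_dom _) (hθ.isClopen_dom _) (hθ.continuous_map g)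
          (hθ.continuous_symm g) f : vanishingOff (θ.dom g)) : C(Y, ℂ)) (θ.map g x) = f.1 x := by
      intro g f x
      refine (push_apply (θ.map g) (hθ.isClopen_dom g) (hθ.continuous_symm g) f
        (θ.map g x)).trans ?_
      rw [Equiv.symm_apply_apply]
    have key : ∀ (y : Y) (hy : y ∈ θ.dom i⁻¹), a.1 y ≠ 0 →
        (θ.map i ⟨y, hy⟩ : Y) ∈ θ.dom h⁻¹ := by
      intro y hy h0
      by_contra h1
      have h2 := ha _ h1
      exact h0 ((ev i a ⟨y, hy⟩).symm.trans h2)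
    have ha' : a.1 ∈ vanishingOff (θ.dom (h * i)⁻¹) := by
      intro y hy
      by_contra h0
      have hyi : y ∈ θ.dom i⁻¹ := by
        by_contra h1
        exact h0 (a.2 y h1)
      refine hy ?_
      rw [mul_inv_rev]
      exact mem_dom_inv_mul hyi (key y hyi h0)
    set b := (pushEquiv (θ.map h) (hθ.isClopen_dom _) (hθ.isClopen_dom _) (hθ.continuous_map h)
          (hθ.continuous_symm h) ⟨_, ha⟩ : vanishingOff (θ.dom h)) with hb
    have key' : ∀ z : Y, b.1 z ≠ 0 → ∃ (y : Y) (_ : y ∈ θ.dom i⁻¹) (hy : y ∈ θ.dom (h * i)⁻¹),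
        (θ.map (h * i) ⟨y, hy⟩ : Y) = z := by
      intro z h0
      have hz : z ∈ θ.dom h := by
        by_contra h1
        exact h0 (b.2 z h1)
      obtain ⟨⟨w, hw⟩, hwz⟩ := (θ.map h).surjective ⟨z, hz⟩
      have hwz' : (θ.map h ⟨w, hw⟩ : Y) = z := congrArg Subtype.val hwz
      rw [← hwz', hb, ev h ⟨_, ha⟩ ⟨w, hw⟩] at h0
      have hwi : w ∈ θ.dom i := by
        by_contra h1
        exact h0 (((pushEquiv (θ.map i) (hθ.isClopen_dom _) (hθ.isClopen_dom _)
          (hθ.continuous_map i) (hθ.continuous_symm i)) a).2 w h1)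
      obtain ⟨⟨y, hy⟩, hyw⟩ := (θ.map i).surjective ⟨w, hwi⟩
      have hyw' : (θ.map i ⟨y, hy⟩ : Y) = w := congrArg Subtype.val hyw
      subst hyw'
      have h2 := mem_dom_inv_mul hy hw
      have h3 : y ∈ θ.dom (h * i)⁻¹ := by rwa [mul_inv_rev]
      exact ⟨y, hy, h3, (θ.map_mul h i y hy h2 hw h3).symm.trans hwz'⟩
    refine ⟨ha', ContinuousMap.ext fun z => ?_⟩
    by_cases hz : z ∈ θ.dom (h * i)
    · obtain ⟨⟨y, hy⟩, hyz⟩ := (θ.map (h * i)).surjective ⟨z, hz⟩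
      have hyz' : (θ.map (h * i) ⟨y, hy⟩ : Y) = z := congrArg Subtype.val hyz
      rw [← hyz']
      refine (ev (h * i) ⟨a.1, ha'⟩ ⟨y, hy⟩).trans ?_
      by_cases hyi : y ∈ θ.dom i⁻¹
      · have h2 : y ∈ θ.dom (i⁻¹ * h⁻¹) := by rwa [← mul_inv_rev]
        have h3 := map_mem_dom_inv hyi h2
        rw [← θ.map_mul h i y hyi h2 h3 hy]
        exact ((ev h ⟨_, ha⟩ ⟨_, h3⟩).trans (ev i a ⟨y, hyi⟩)).symm
      · refine (a.2 y hyi).trans ?_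
        by_contra h0
        obtain ⟨y', h1, h2, h3⟩ := key' _ (Ne.symm h0)
        have := (θ.map (h * i)).injective (Subtype.ext h3)
        have h4 : y' = y := congrArg Subtype.val this
        exact hyi (h4 ▸ h1)
    · refine (pushFun_of_notMem _ _ hz).trans ?_
      by_contra h0
      obtain ⟨y', h1, h2, h3⟩ := key' _ (Ne.symm h0)
      exact hz (h3 ▸ (θ.map (h * i) ⟨y', h2⟩).2)

end Functions

/-- The partial action of `G` on the C*-algebra `C(X̂)` of continuous functions on the dual space
`X̂` of the Boolean algebra generated by the domains. -/
def dualCStarAction : CStarPartialAction G C(θ.Dual, ℂ) :=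
  θ.isClopenAction_dualAction.toCStar

/-- The defining relations of the C*-algebra of `(X, θ, G)`, for a family `s` of elements of a
unital C*-algebra `B`. The last one says that `D g ↦ s g * (s g)*` extends to a Boolean
homomorphism `β` from the Boolean algebra generated by the domains to the Boolean algebra of
projections of the (commutative) C*-algebra generated by the `s g * (s g)*`, whose operations are
`p ∧ q = p q`, `p ∨ q = p + q - p q` and `¬ p = 1 - p`. -/
structure DefiningRelations {B : Type*} [CStarAlgebra B] (s : G → B) : Prop where
  partial_isometry : ∀ g, s g * star (s g) * s g = s g
  commute : ∀ g h, Commute (s g * star (s g)) (s h * star (s h))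
  one : s 1 = 1
  inv : ∀ g, s g⁻¹ = star (s g)
  mul : ∀ h i, s h * s i = s h * star (s h) * s (h * i)
  boolean : ∃ β : θ.boolAlg → B,
    (∀ a, IsStarProjection (β a)) ∧
    (∀ a, β a ∈
      (StarAlgebra.adjoin ℂ (Set.range fun g => s g * star (s g))).topologicalClosure) ∧
    (∀ a b, β (a ⊓ b) = β a * β b) ∧
    (∀ a b, β (a ⊔ b) = β a + β b - β a * β b) ∧
    (∀ a, β aᶜ = 1 - β a) ∧
    ∀ g, β (θ.domB g) = s g * star (s g)

end PartialAction

end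

/-!
Write `X̂` for the dual space, `1_g` for the characteristic function of `D̂ g` and `α` for the partial
action on `C(X̂)`. The generators are `s_g = 1_g δ_g`. A computation on coefficients, which rests on
`α_g(1_{g⁻¹} 1_h) = 1_g 1_{gh}` (`act_domFun_mul_domFun`), gives `s_g s_g* = 1_g δ_1` and the other
relations (`definingRelations_gen`). The functions `1_g` separate the points of `X̂`, so by
Stone–Weierstrass they generate `C(X̂)` (`adjoin_domFun`); since `f δ_g = (f δ_1) s_g`, the `s_g`
generate the crossed product (`adjoin_gen`), which also gives uniqueness.

For the universal property, let `S` satisfy the relations in `B`, with Boolean homomorphism `β`. The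
projections `β A` lie in a commutative C*-algebra, and composing its characters with `β` gives a
continuous map from its character space to `X̂`. By Gelfand duality this map is the transpose of a
`*`-homomorphism `π : C(X̂) → B` with `π(1_g) = S_g S_g*` (`DefiningRelations.exists_hom`). The pair
`(π, S)` is covariant, `S_g π(f) S_g* = π(α_g(f))` for `f ∈ D g⁻¹`: both `S_g π(f) S_g*` and
`π(α_g(1_{g⁻¹} f))` are `*`-homomorphisms in `f ∈ C(X̂)`, so that it suffices to compare them on the
`1_h` (`DefiningRelations.isCovariant`). Then `∑ f_g δ_g ↦ ∑ π(f_g) S_g` is a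
`*`-homomorphism on the algebraic crossed product. Composed with the norm of `B` it is a C*-seminorm,
hence it is bounded by the greatest one and extends to the completion (`IsCovariant.lift`).
-/

noncomputable section

/-! ### Extension of `*`-homomorphisms to completions -/

namespace CStarSeminorm

variable {R B : Type*} [Ring R] [StarRing R] [Algebra ℂ R] [CStarAlgebra B]

variable (B) in
/-- The norm of a C*-algebra, as a C*-seminorm. -/
def ofNorm : CStarSeminorm B where
  toSeminorm := normSeminorm ℂ B
  mul_le' := norm_mul_le
  star_mul_self' x := by
    change ‖star x * x‖ = ‖x‖ ^ 2
    rw [CStarRing.norm_star_mul_self, sq]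

theorem continuous_of_norm_le (p : CStarSeminorm R) (f : R →⋆ₐ[ℂ] B) (hf : ∀ x, ‖f x‖ ≤ p x) :
    Continuous fun x : p.Carrier => f x :=
  AddMonoidHomClass.continuous_of_bound
    (show p.Carrier →+ B from (f : R →+* B).toAddMonoidHom) 1 fun x => by
      rw [one_mul]; exact hf x

variable [StarModule ℂ R]

/-- A `*`-homomorphism into a C*-algebra which is bounded by a C*-seminorm extends to the
completion. -/
def lift (p : CStarSeminorm R) (f : R →⋆ₐ[ℂ] B) (hf : ∀ x, ‖f x‖ ≤ p x) :
    p.Completion →⋆ₐ[ℂ] B :=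
  let F : p.Completion →+* B := UniformSpace.Completion.extensionHom
    (show p.Carrier →+* B from (f : R →+* B)) (p.continuous_of_norm_le f hf)
  have hF : ∀ x : R, F (p.toCompletion x) = f x := fun x =>
    UniformSpace.Completion.extensionHom_coe
      (show p.Carrier →+* B from (f : R →+* B)) (p.continuous_of_norm_le f hf) x
  { F with
    commutes' := fun c => by
      have h := hF (algebraMap ℂ R c)
      rw [AlgHomClass.commutes p.toCompletion, AlgHomClass.commutes f] at h
      exact h
    map_star' := fun x => by
      have hc : Continuous F := UniformSpace.Completion.continuous_extension
      change F (star x) = star (F x)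
      induction x using UniformSpace.Completion.induction_on with
      | hp => exact isClosed_eq (hc.comp continuous_star) hc.star
      | ih y =>
        let z : R := y
        exact ((congrArg F (map_star p.toCompletion z)).symm.trans (hF (star z))).trans
          ((map_star f z).trans (congrArg star (hF z).symm)) }

theorem lift_toCompletion (p : CStarSeminorm R) (f : R →⋆ₐ[ℂ] B) (hf : ∀ x, ‖f x‖ ≤ p x) (x : R) :
    p.lift f hf (p.toCompletion x) = f x :=
  UniformSpace.Completion.extensionHom_coe
    (show p.Carrier →+* B from (f : R →+* B)) (p.continuous_of_norm_le f hf) x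

end CStarSeminorm

theorem StarAlgHom.continuous_of_cStarAlgebra {A B : Type*} [CStarAlgebra A] [CStarAlgebra B]
    (f : A →⋆ₐ[ℂ] B) : Continuous f :=
  AddMonoidHomClass.continuous_of_bound f 1 fun x => by
    rw [one_mul]; exact NonUnitalStarAlgHom.norm_apply_le f x

/-- A `*`-homomorphism maps the closed `*`-subalgebra generated by a set into every
closed `*`-subalgebra containing the images of the generators. -/
theorem StarAlgHom.map_mem_of_mem_topologicalClosure_adjoin {A B : Type*} [CStarAlgebra A]
    [CStarAlgebra B] (f : A →⋆ₐ[ℂ] B) {s : Set A} {T : StarSubalgebra ℂ B}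
    (hT : IsClosed (T : Set B)) (h : ∀ a ∈ s, f a ∈ T) {a : A}
    (ha : a ∈ (StarAlgebra.adjoin ℂ s).topologicalClosure) : f a ∈ T := by
  have hle : (StarAlgebra.adjoin ℂ s).topologicalClosure ≤ T.comap f :=
    StarSubalgebra.topologicalClosure_minimal (StarAlgebra.adjoin_le h)
      (hT.preimage (f.continuous_of_cStarAlgebra))
  exact hle ha

/-! ### Covariant pairs and their integrated forms -/

namespace CStarPartialAction

open AlgCrossedProduct

variable {G A B : Type*} [Group G] [CStarAlgebra A] [CStarAlgebra B] (α : CStarPartialAction G A)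

/-- A covariant pair in `B`: a representation `π` of the coefficients and a family `S` which
implements the partial action. The range projection of `S g` is required to commute with all of
`π A` and to act as a unit on the image of the ideal `D g`, so that no nondegeneracy or
approximate unit arguments are needed. -/
structure IsCovariant (π : A →⋆ₐ[ℂ] B) (S : G → B) : Prop where
  one : S 1 = 1
  inv : ∀ g, S g⁻¹ = star (S g)
  mul : ∀ g h, S g * S h = S g * star (S g) * S (g * h)
  conj : ∀ g, ∀ a ∈ α.ideal g⁻¹, S g * π a * star (S g) = π (α.act g a)
  absorb : ∀ g, ∀ a ∈ α.ideal g, S g * star (S g) * π a = π a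
  commute : ∀ g a, Commute (S g * star (S g)) (π a)

namespace IsCovariant

variable {α} {π : A →⋆ₐ[ℂ] B} {S : G → B} (h : α.IsCovariant π S)

/-- The linear map `∑ a_g δ_g ↦ ∑ π(a_g) S_g`. -/
def linear (π : A →⋆ₐ[ℂ] B) (S : G → B) : α.AlgCrossedProduct →ₗ[ℂ] B :=
  open Classical in
  DirectSum.toModule ℂ G B fun g =>
    (LinearMap.mulRight ℂ (S g)) ∘ₗ (π : A →ₐ[ℂ] B).toLinearMap ∘ₗ
      (α.ideal g).toSubmodule.subtype

theorem linear_single {g : G} {a : A} (ha : a ∈ α.ideal g) :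
    linear π S (single g a ha) = π a * S g := by
  classical
  exact DirectSum.toModule_lof (M := fun g => α.ideal g) ℂ g ⟨a, ha⟩

include h in
theorem linear_mul_single {g k : G} {a b : A} (ha : a ∈ α.ideal g) :
    π (α.act g (α.act g⁻¹ a * b)) * S (g * k) = π a * S g * (π b * S k) := by
  have ha' : a ∈ α.ideal g⁻¹⁻¹ := by rwa [inv_inv]
  have h1 := h.conj g _ (α.mul_mem_right g⁻¹ _ b (act_inv_mem ha))
  have h2 := h.conj g⁻¹ a ha'
  have h3 := h.mul g⁻¹ (g * k)
  have h4 := (h.commute g⁻¹ b).eq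
  have h5 := h.absorb g a ha
  have h7 := (h.commute g a).eq
  have h8 := h.mul g⁻¹ k
  simp only [h.inv, star_star, inv_mul_cancel_left] at h2 h3 h4 h8
  rw [← h1, map_mul, ← h2]
  -- `π(α_g⁻¹(a)) = S_g* π(a) S_g`, and `S_g* S_{gk} = S_g* S_g S_k` by the relation for `g⁻¹`
  calc S g * (star (S g) * π a * S g * π b) * star (S g) * S (g * k)
      = (S g * star (S g) * π a) * S g * π b * (star (S g) * S (g * k)) := by noncomm_ring
    _ = π a * S g * (π b * (star (S g) * S g)) * S k := by rw [h5, h3]; noncomm_ring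
    _ = π a * (S g * star (S g)) * S g * π b * S k := by rw [← h4]; noncomm_ring
    _ = π a * S g * (π b * S k) := by rw [← h7, h5]; noncomm_ring

include h in
theorem linear_star_single {g : G} {a : A} (ha : a ∈ α.ideal g) :
    π (α.act g⁻¹ (star a)) * S g⁻¹ = star (π a * S g) := by
  have ha' : star a ∈ α.ideal g⁻¹⁻¹ := by rw [inv_inv]; exact star_mem ha
  have h2 := h.conj g⁻¹ _ ha'
  have h5 := h.absorb g _ (star_mem ha)
  have h7 := (h.commute g (star a)).eq
  simp only [h.inv, star_star] at h2
  rw [← h2, h.inv, star_mul, ← map_star]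
  calc star (S g) * π (star a) * S g * star (S g)
      = star (S g) * (π (star a) * (S g * star (S g))) := by noncomm_ring
    _ = star (S g) * π (star a) := by rw [← h7, h5]

/-- The integrated form `∑ a_g δ_g ↦ ∑ π(a_g) S_g` of a covariant pair on the algebraic crossed
product. -/
def algLift : α.AlgCrossedProduct →⋆ₐ[ℂ] B :=
  { AlgHom.ofLinearMap (linear π S)
      (by rw [one_def, linear_single, map_one, one_mul, h.one])
      (fun x y => by
        induction x using AlgCrossedProduct.induction with
        | zero => simp
        | add x x' hx hx' => rw [add_mul, map_add, hx, hx', map_add, add_mul]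
        | single g a ha =>
        induction y using AlgCrossedProduct.induction with
        | zero => simp
        | add x x' hx hx' => rw [mul_add, map_add, hx, hx', map_add, mul_add]
        | single k b hb =>
          rw [single_mul_single, linear_single, linear_single, linear_single,
            h.linear_mul_single ha]) with
    map_star' := fun x => by
      change linear π S (star x) = star (linear π S x)
      induction x using AlgCrossedProduct.induction with
      | zero => simp
      | add x x' hx hx' => rw [star_add, map_add, hx, hx', map_add, star_add]
      | single g a ha =>
        rw [star_single, linear_single, linear_single, h.linear_star_single ha] }

theorem algLift_single {g : G} {a : A} (ha : a ∈ α.ideal g) :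
    h.algLift (single g a ha) = π a * S g :=
  linear_single ha

theorem norm_algLift_le (x : α.AlgCrossedProduct) : ‖h.algLift x‖ ≤ α.maxSeminorm x :=
  le_ciSup (bddAbove_seminorm x) ((CStarSeminorm.ofNorm B).comap h.algLift)

/-- The integrated form of a covariant pair on the crossed product. -/
def lift : α.CrossedProduct →⋆ₐ[ℂ] B :=
  α.maxSeminorm.lift h.algLift h.norm_algLift_le

theorem lift_single {g : G} {a : A} (ha : a ∈ α.ideal g) :
    h.lift (α.maxSeminorm.toCompletion (single g a ha)) = π a * S g :=
  (α.maxSeminorm.lift_toCompletion _ _ _).trans (h.algLift_single ha)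

end IsCovariant

end CStarPartialAction

/-! ### Characteristic functions on the dual space -/

namespace PartialAction

open CStarPartialAction

variable {G X : Type*} [Group G] {θ : PartialAction G X}

namespace Dual

open Classical in
/-- The characteristic function of the clopen set `{φ | φ A = 1}` of the dual space. -/
def charFun (A : θ.boolAlg) : C(θ.Dual, ℂ) :=
  ⟨fun φ => if φ.1 A = true then 1 else 0,
    (continuous_of_discreteTopology (f := fun b : Bool => if b = true then (1 : ℂ) else 0)).comp
      (continuous_eval θ A)⟩

theorem charFun_of_eq_true {A : θ.boolAlg} {φ : θ.Dual} (h : φ.1 A = true) :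
    charFun A φ = 1 := if_pos h

theorem charFun_of_ne_true {A : θ.boolAlg} {φ : θ.Dual} (h : φ.1 A ≠ true) :
    charFun A φ = 0 := if_neg h

theorem charFun_inf (A B : θ.boolAlg) : charFun (A ⊓ B) = charFun A * charFun B := by
  ext φ
  have h := φ.2.map_inf A B
  rw [ContinuousMap.mul_apply]
  cases hA : φ.1 A <;> cases hB : φ.1 B <;> simp_all [charFun]

theorem charFun_sup (A B : θ.boolAlg) :
    charFun (A ⊔ B) = charFun A + charFun B - charFun A * charFun B := by
  ext φ
  have h := φ.2.map_sup A B
  rw [ContinuousMap.sub_apply, ContinuousMap.add_apply, ContinuousMap.mul_apply]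
  cases hA : φ.1 A <;> cases hB : φ.1 B <;> simp_all [charFun]

theorem charFun_compl (A : θ.boolAlg) : charFun Aᶜ = 1 - charFun A := by
  ext φ
  have h := φ.2.map_compl A
  rw [ContinuousMap.sub_apply, ContinuousMap.one_apply]
  cases hA : φ.1 A <;> simp_all [charFun]

theorem isStarProjection_charFun (A : θ.boolAlg) : IsStarProjection (charFun A) where
  isIdempotentElem := by rw [IsIdempotentElem, ← charFun_inf, inf_idem]
  isSelfAdjoint := by
    ext φ
    rw [ContinuousMap.star_apply]
    cases hA : φ.1 A <;> simp [charFun, hA]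

variable (θ) in
/-- The characteristic function of the domain `D̂ g`. -/
def domFun (g : G) : C(θ.Dual, ℂ) := charFun (θ.domB g)

theorem domFun_of_mem {g : G} {φ : θ.Dual} (h : φ ∈ dom θ g) : domFun θ g φ = 1 :=
  charFun_of_eq_true h

theorem domFun_of_notMem {g : G} {φ : θ.Dual} (h : φ ∉ dom θ g) : domFun θ g φ = 0 :=
  charFun_of_ne_true h

theorem domFun_one : domFun θ 1 = 1 := by
  ext φ; exact domFun_of_mem (mem_dom_one φ)

theorem domFun_mul_self (g : G) : domFun θ g * domFun θ g = domFun θ g :=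
  (isStarProjection_charFun _).isIdempotentElem

theorem star_domFun (g : G) : star (domFun θ g) = domFun θ g :=
  (isStarProjection_charFun _).isSelfAdjoint

theorem domFun_mem (g : G) : domFun θ g ∈ θ.dualCStarAction.ideal g :=
  fun _ h => domFun_of_notMem h

theorem domFun_mul_of_mem {g : G} {f : C(θ.Dual, ℂ)} (hf : f ∈ θ.dualCStarAction.ideal g) :
    domFun θ g * f = f := by
  ext φ
  rw [ContinuousMap.mul_apply]
  by_cases h : φ ∈ dom θ g
  · rw [domFun_of_mem h, one_mul]
  · rw [domFun_of_notMem h, zero_mul, hf φ h]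

theorem domFun_mul_mem (g : G) (f : C(θ.Dual, ℂ)) :
    domFun θ g * f ∈ θ.dualCStarAction.ideal g :=
  θ.dualCStarAction.mul_mem_right _ _ _ (domFun_mem g)

theorem act_apply_of_mem {g : G} {f : C(θ.Dual, ℂ)} (hf : f ∈ θ.dualCStarAction.ideal g⁻¹)
    {φ : θ.Dual} (h : φ ∈ dom θ g) :
    θ.dualCStarAction.act g f φ = f (mapFun g⁻¹ ⟨φ, mem_dom_inv_inv h⟩) := by
  rw [act_eq hf]
  exact pushFun_of_mem (θ.dualAction.map g) f h

theorem act_domFun_mul_domFun (g h : G) :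
    θ.dualCStarAction.act g (domFun θ g⁻¹ * domFun θ h) = domFun θ g * domFun θ (g * h) := by
  have hm := domFun_mul_mem g⁻¹ (domFun θ h)
  ext φ
  rw [ContinuousMap.mul_apply]
  by_cases hφ : φ ∈ dom θ g
  · have key : mapFun g⁻¹ ⟨φ, mem_dom_inv_inv hφ⟩ ∈ dom θ h ↔ φ ∈ dom θ (g * h) :=
      (mapFun_mem_dom g⁻¹ h ⟨φ, mem_dom_inv_inv hφ⟩).trans (by simp only [inv_inv])
    rw [act_apply_of_mem hm hφ, ContinuousMap.mul_apply, domFun_of_mem hφ, one_mul,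
      domFun_of_mem (mapFun_mem _ _), one_mul]
    by_cases h1 : φ ∈ dom θ (g * h)
    · rw [domFun_of_mem h1, domFun_of_mem (key.2 h1)]
    · rw [domFun_of_notMem h1, domFun_of_notMem (mt key.1 h1)]
  · rw [domFun_of_notMem hφ, zero_mul]
    exact act_mem hm φ hφ

theorem act_domFun (g : G) : θ.dualCStarAction.act g (domFun θ g⁻¹) = domFun θ g := by
  have h := act_domFun_mul_domFun (θ := θ) g 1
  rwa [domFun_one, mul_one, mul_one, domFun_mul_self] at h

theorem act_inv_domFun (g : G) : θ.dualCStarAction.act g⁻¹ (domFun θ g) = domFun θ g⁻¹ := by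
  have h := act_domFun (θ := θ) g⁻¹
  rwa [inv_inv] at h

/-- A point of the dual space is determined by the domains to which it belongs. -/
theorem ext_dom {φ ψ : θ.Dual} (h : ∀ g, φ ∈ dom θ g ↔ ψ ∈ dom θ g) : φ = ψ := by
  refine Subtype.ext (funext fun ⟨A, hA⟩ => ?_)
  have hbot : ∀ χ : θ.Dual, χ.1 ⊥ = false := fun χ => by
    rw [← compl_top, χ.2.map_compl, map_top]; rfl
  refine BooleanSubalgebra.closure_bot_sup_induction
    (p := fun A hA => φ.1 ⟨A, hA⟩ = ψ.1 ⟨A, hA⟩) ?_ ?_ ?_ ?_ hA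
  · rintro _ ⟨g, rfl⟩
    exact Bool.eq_iff_iff.2 (h g)
  · exact (hbot φ).trans (hbot ψ).symm
  · intro A hA B hB h1 h2
    have e : ∀ χ : θ.Dual, χ.1 ⟨A ⊔ B, BooleanSubalgebra.sup_mem hA hB⟩
        = χ.1 ⟨A, hA⟩ ⊔ χ.1 ⟨B, hB⟩ := fun χ => χ.2.map_sup ⟨A, hA⟩ ⟨B, hB⟩
    exact (e φ).trans ((congrArg₂ (· ⊔ ·) h1 h2).trans (e ψ).symm)
  · intro A hA h1
    have e : ∀ χ : θ.Dual, χ.1 ⟨Aᶜ, BooleanSubalgebra.compl_mem hA⟩ = (χ.1 ⟨A, hA⟩)ᶜ :=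
      fun χ => χ.2.map_compl ⟨A, hA⟩
    exact (e φ).trans ((congrArg _ h1).trans (e ψ).symm)

/-- By the Stone–Weierstrass theorem, the characteristic functions of the domains generate the
C*-algebra of continuous functions on the dual space. -/
theorem adjoin_domFun :
    (StarAlgebra.adjoin ℂ (Set.range (domFun θ))).topologicalClosure = ⊤ := by
  refine ContinuousMap.starSubalgebra_topologicalClosure_eq_top_of_separatesPoints _ ?_
  intro φ ψ hne
  by_contra! hcon
  refine hne (ext_dom fun g => ?_)
  have := hcon _ ⟨domFun θ g, StarAlgebra.subset_adjoin ℂ _ ⟨g, rfl⟩, rfl⟩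
  by_cases h1 : φ ∈ dom θ g <;> by_cases h2 : ψ ∈ dom θ g <;>
    simp_all [domFun_of_mem, domFun_of_notMem]

/-- Non-unital `*`-homomorphisms suffice here, since the unit is itself the characteristic
function of the domain `D̂ 1`. -/
theorem hom_ext {B : Type*} [CStarAlgebra B] {F F' : C(θ.Dual, ℂ) →⋆ₙₐ[ℂ] B}
    (h : ∀ g, F (domFun θ g) = F' (domFun θ g)) : F = F' := by
  have cont : ∀ F : C(θ.Dual, ℂ) →⋆ₙₐ[ℂ] B, Continuous F := fun F =>
    AddMonoidHomClass.continuous_of_bound F 1 fun x => by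
      rw [one_mul]; exact NonUnitalStarAlgHom.norm_apply_le F x
  have h1 : F 1 = F' 1 := by rw [← domFun_one]; exact h 1
  ext f
  have hf : f ∈ closure (StarAlgebra.adjoin ℂ (Set.range (domFun θ)) : Set C(θ.Dual, ℂ)) := by
    rw [← StarSubalgebra.topologicalClosure_coe, adjoin_domFun]; trivial
  refine closure_minimal (t := {f | F f = F' f}) ?_ (isClosed_eq (cont F) (cont F')) hf
  intro f hf
  change F f = F' f
  induction hf using StarAlgebra.adjoin_induction with
  | mem x hx => obtain ⟨g, rfl⟩ := hx; exact h g
  | algebraMap c => rw [Algebra.algebraMap_eq_smul_one, map_smul, map_smul, h1]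
  | add x y _ _ hx hy => rw [map_add, map_add, hx, hy]
  | mul x y _ _ hx hy => rw [_root_.map_mul, _root_.map_mul, hx, hy]
  | star x _ hx => rw [map_star, map_star, hx]

/-! ### Representations of the functions on the dual space -/

variable (θ) in
/-- The `*`-homomorphism `f ↦ α_g(1_{g⁻¹} f)`, with `1_{g⁻¹}` the unit of the ideal `D g⁻¹`. -/
def actHom (g : G) : C(θ.Dual, ℂ) →⋆ₙₐ[ℂ] C(θ.Dual, ℂ) where
  toFun f := θ.dualCStarAction.act g (domFun θ g⁻¹ * f)
  map_smul' c f := by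
    rw [mul_smul_comm, act_smul _ (domFun_mul_mem _ _)]; rfl
  map_zero' := by rw [mul_zero, act_zero]
  map_add' f f' := by rw [mul_add, act_add (domFun_mul_mem _ _) (domFun_mul_mem _ _)]
  map_mul' f f' := by
    rw [← act_mul (domFun_mul_mem _ _) (domFun_mul_mem _ _), mul_mul_mul_comm, domFun_mul_self]
  map_star' f := by
    rw [← act_star (domFun_mul_mem _ _), star_mul', star_domFun]

theorem actHom_apply (g : G) (f : C(θ.Dual, ℂ)) :
    actHom θ g f = θ.dualCStarAction.act g (domFun θ g⁻¹ * f) := rfl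

/-- A Boolean homomorphism from the Boolean algebra generated by the domains to the projections of
a commutative C*-algebra `D` is induced by a `*`-homomorphism `C(X̂) → D`. By Gelfand duality it
comes from the continuous map which composes a character of `D` with the given homomorphism. -/
theorem exists_hom_of_comm {D : Type*} [CommCStarAlgebra D] {β : θ.boolAlg → D}
    (hp : ∀ a, IsIdempotentElem (β a)) (hinf : ∀ a b, β (a ⊓ b) = β a * β b)
    (hsup : ∀ a b, β (a ⊔ b) = β a + β b - β a * β b) (hcompl : ∀ a, β aᶜ = 1 - β a) :
    ∃ π : C(θ.Dual, ℂ) →⋆ₐ[ℂ] D, ∀ a, π (charFun a) = β a := by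
  classical
  let K := WeakDual.characterSpace ℂ D
  have h01 : ∀ (ψ : K) a, ψ (β a) = 0 ∨ ψ (β a) = 1 := fun ψ a =>
    IsIdempotentElem.iff_eq_zero_or_one.1 ((hp a).map ψ)
  let F : K → θ.Dual := fun ψ => ⟨fun a => decide (ψ (β a) = 1),
    { map_inf := fun a b => by
        rcases h01 ψ a with h | h <;> rcases h01 ψ b with h' | h' <;> simp [hinf, h, h']
      map_sup := fun a b => by
        rcases h01 ψ a with h | h <;> rcases h01 ψ b with h' | h' <;> simp [hsup, h, h']
      map_compl := fun a => by
        rcases h01 ψ a with h | h <;> simp [hcompl, h] }⟩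
  have hev : ∀ d : D, Continuous fun ψ : K => ψ d := fun d =>
    (WeakDual.gelfandTransform ℂ D d).continuous
  have hF : Continuous F := by
    refine Continuous.subtype_mk (continuous_pi fun a => ?_) _
    refine (continuous_bool_rng true).2 ⟨?_, ?_⟩
    · have : (fun ψ : K => decide (ψ (β a) = 1)) ⁻¹' {true} = {ψ | ψ (β a) = 1} := by
        ext ψ; simp
      rw [this]
      exact isClosed_eq (hev _) continuous_const
    · have : (fun ψ : K => decide (ψ (β a) = 1)) ⁻¹' {true} = {ψ | ψ (β a) ≠ 0} := by
        ext ψ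
        rcases h01 ψ a with h | h <;> simp [h]
      rw [this]
      exact isOpen_ne_fun (hev _) continuous_const
  refine ⟨((gelfandStarTransform D).symm : C(K, ℂ) →⋆ₐ[ℂ] D).comp
    (ContinuousMap.compStarAlgHom' ℂ ℂ ⟨F, hF⟩), fun a => ?_⟩
  refine (gelfandStarTransform D).injective ?_
  refine ((gelfandStarTransform D).apply_symm_apply _).trans ?_
  ext ψ
  change (if decide (ψ (β a) = 1) = true then (1 : ℂ) else 0) = ψ (β a)
  rcases h01 ψ a with h | h <;> simp [h]

end Dual

namespace DefiningRelations

open PartialAction.Dual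

variable {B : Type*} [CStarAlgebra B] {S : G → B}

/-- The range projections of a family satisfying the defining relations come from a representation
of the continuous functions on the dual space. -/
theorem exists_hom (hS : θ.DefiningRelations S) :
    ∃ π : C(θ.Dual, ℂ) →⋆ₐ[ℂ] B, ∀ g, π (domFun θ g) = S g * star (S g) := by
  obtain ⟨β, hp, hm, hinf, hsup, hcompl, hdom⟩ := hS.boolean
  set s := Set.range fun g => S g * star (S g)
  have hcomm : ∀ x ∈ s, ∀ y ∈ s, x * y = y * x := by
    rintro _ ⟨g, rfl⟩ _ ⟨k, rfl⟩; exact hS.commute g k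
  have hcomm' : ∀ x ∈ s, ∀ y ∈ s, x * star y = star y * x := by
    rintro _ ⟨g, rfl⟩ _ ⟨k, rfl⟩
    rw [star_mul, star_star]
    exact hS.commute g k
  have := StarAlgebra.isMulCommutative_adjoin ℂ hcomm hcomm'
  let D := (StarAlgebra.adjoin ℂ s).topologicalClosure
  have hD : IsClosed (D : Set B) := StarSubalgebra.isClosed_topologicalClosure _
  let _ : CommCStarAlgebra D :=
    { (inferInstance : CStarAlgebra D) with
      mul_comm := (StarSubalgebra.commRingTopologicalClosure (StarAlgebra.adjoin ℂ s)
        fun x y => mul_comm' x y).mul_comm }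
  obtain ⟨π, hπ⟩ := exists_hom_of_comm (θ := θ) (β := fun a => (⟨β a, hm a⟩ : D))
    (fun a => Subtype.ext (hp a).isIdempotentElem) (fun a b => Subtype.ext (hinf a b))
    (fun a b => Subtype.ext (hsup a b)) (fun a => Subtype.ext (hcompl a))
  refine ⟨D.subtype.comp π, fun g => ?_⟩
  rw [← hdom g]
  exact congrArg Subtype.val (hπ (θ.domB g))

theorem isCovariant (hS : θ.DefiningRelations S) {π : C(θ.Dual, ℂ) →⋆ₐ[ℂ] B}
    (hπ : ∀ g, π (domFun θ g) = S g * star (S g)) : θ.dualCStarAction.IsCovariant π S where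
  one := hS.one
  inv := hS.inv
  mul := hS.mul
  absorb g a ha := by rw [← hπ, ← _root_.map_mul, domFun_mul_of_mem ha]
  commute g a := by rw [← hπ]; exact (Commute.all _ _).map π
  conj g := by
    have hc : ∀ f, star (S g) * S g * π f = π f * (star (S g) * S g) := fun f => by
      have h := hπ g⁻¹
      rw [hS.inv, star_star] at h
      rw [← h, ← _root_.map_mul, ← _root_.map_mul, mul_comm]
    -- The initial projection of `S g` commutes with the image of `π`, so conjugation by `S g` is
    -- multiplicative there.
    let F : C(θ.Dual, ℂ) →⋆ₙₐ[ℂ] B :=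
      { toFun := fun f => S g * π f * star (S g)
        map_smul' := fun c f => by simp
        map_zero' := by simp
        map_add' := fun f f' => by rw [map_add, mul_add, add_mul]
        map_mul' := fun f f' => by
          calc S g * π (f * f') * star (S g)
              = S g * star (S g) * S g * (π f * π f') * star (S g) := by
                rw [hS.partial_isometry, _root_.map_mul]
            _ = S g * (star (S g) * S g * π f) * π f' * star (S g) := by noncomm_ring
            _ = S g * π f * star (S g) * (S g * π f' * star (S g)) := by
                rw [hc]; noncomm_ring
        map_star' := fun f => by rw [map_star, star_mul, star_mul, star_star, mul_assoc] }
    have hF : F = (π : C(θ.Dual, ℂ) →⋆ₙₐ[ℂ] B).comp (actHom θ g) := hom_ext fun k => by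
      change S g * π (domFun θ k) * star (S g) = π (actHom θ g (domFun θ k))
      rw [actHom_apply, act_domFun_mul_domFun, _root_.map_mul, hπ, hπ, hπ]
      have h1 := hS.mul g k
      have h2 : star (S k) * star (S g) = star (S (g * k)) * (S g * star (S g)) := by
        rw [← star_mul, h1]; simp [mul_assoc]
      calc S g * (S k * star (S k)) * star (S g)
          = (S g * S k) * (star (S k) * star (S g)) := by noncomm_ring
        _ = S g * star (S g) * (S (g * k) * star (S (g * k)) * (S g * star (S g))) := by
          rw [h1, h2]; noncomm_ring
        _ = (S g * star (S g) * S g) * star (S g) * (S (g * k) * star (S (g * k))) := by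
          rw [(hS.commute (g * k) g).eq]; noncomm_ring
        _ = _ := by rw [hS.partial_isometry]
    intro f hf
    have h := DFunLike.congr_fun hF f
    change S g * π f * star (S g) = π (actHom θ g f) at h
    rw [h, actHom_apply, domFun_mul_of_mem hf]

end DefiningRelations

/-! ### The generators of the crossed product -/

namespace Dual

open AlgCrossedProduct

variable (θ) in
/-- The element `1_g δ_g` of the algebraic crossed product, with `1_g` the unit of the ideal
`D g`. -/
def algGen (g : G) : θ.dualCStarAction.AlgCrossedProduct := single g (domFun θ g) (domFun_mem g)

theorem coeff_mul_single {g : G} (a : C(θ.Dual, ℂ)) {b : C(θ.Dual, ℂ)}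
    (hb : b ∈ θ.dualCStarAction.ideal g) :
    coeff θ.dualCStarAction a * single g b hb
      = single g (a * b) (θ.dualCStarAction.mul_mem_left _ _ _ hb) := by
  refine (single_mul_single (mem_ideal_one a) hb).trans (single_congr (one_mul g) ?_)
  rw [inv_one, act_one, act_one]

theorem algGen_one : algGen θ 1 = 1 := single_congr rfl domFun_one

theorem star_algGen (g : G) : star (algGen θ g) = algGen θ g⁻¹ :=
  (star_single (domFun_mem g)).trans <| single_congr rfl <| by rw [star_domFun, act_inv_domFun]

theorem algGen_mul (g h : G) :
    algGen θ g * algGen θ h = coeff θ.dualCStarAction (domFun θ g) * algGen θ (g * h) := by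
  refine (single_mul_single (domFun_mem g) (domFun_mem h)).trans ?_
  refine Eq.trans ?_ (coeff_mul_single _ _).symm
  exact single_congr rfl (by rw [act_inv_domFun, act_domFun_mul_domFun])

theorem algGen_mul_star (g : G) :
    algGen θ g * star (algGen θ g) = coeff θ.dualCStarAction (domFun θ g) := by
  rw [star_algGen, algGen_mul, mul_inv_cancel, algGen_one, mul_one]

theorem coeff_mul_algGen {g : G} {f : C(θ.Dual, ℂ)} (hf : f ∈ θ.dualCStarAction.ideal g) :
    coeff θ.dualCStarAction f * algGen θ g = single g f hf :=
  (coeff_mul_single _ _).trans (single_congr rfl (by rw [mul_comm, domFun_mul_of_mem hf]))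

variable (θ) in
/-- The generator `1_g δ_g` of the crossed product. -/
def gen (g : G) : θ.dualCStarAction.CrossedProduct :=
  θ.dualCStarAction.maxSeminorm.toCompletion (algGen θ g)

variable (θ) in
/-- The coefficient homomorphism of the crossed product. -/
def coeffHom : C(θ.Dual, ℂ) →⋆ₐ[ℂ] θ.dualCStarAction.CrossedProduct :=
  θ.dualCStarAction.maxSeminorm.toCompletion.comp (coeff θ.dualCStarAction)

theorem gen_mul_star (g : G) : gen θ g * star (gen θ g) = coeffHom θ (domFun θ g) := by
  rw [gen, ← map_star, ← _root_.map_mul, algGen_mul_star]; rfl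

theorem definingRelations_gen : θ.DefiningRelations (gen θ) where
  partial_isometry g := by
    rw [gen_mul_star]
    refine (_root_.map_mul θ.dualCStarAction.maxSeminorm.toCompletion _ _).symm.trans ?_
    exact congrArg _ (coeff_mul_algGen (domFun_mem g))
  commute g h := by
    rw [gen_mul_star, gen_mul_star]; exact (Commute.all _ _).map (coeffHom θ)
  one := by rw [gen, algGen_one, _root_.map_one]
  inv g := by rw [gen, gen, ← map_star, star_algGen]
  mul h i := by
    rw [gen_mul_star, gen, gen, ← _root_.map_mul, algGen_mul, _root_.map_mul]; rfl
  boolean := by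
    refine ⟨fun a => coeffHom θ (charFun a), fun a => (isStarProjection_charFun a).map _,
      fun a => ?_, fun a b => ?_, fun a b => ?_, fun a => ?_, fun g => (gen_mul_star g).symm⟩
    · refine (coeffHom θ).map_mem_of_mem_topologicalClosure_adjoin (s := Set.range (domFun θ))
        (StarSubalgebra.isClosed_topologicalClosure _) ?_ (by rw [adjoin_domFun]; trivial)
      rintro _ ⟨g, rfl⟩
      rw [← gen_mul_star]
      exact StarSubalgebra.le_topologicalClosure _ (StarAlgebra.subset_adjoin ℂ _ ⟨g, rfl⟩)
    · beta_reduce; rw [charFun_inf, _root_.map_mul]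
    · beta_reduce; rw [charFun_sup, map_sub, map_add, _root_.map_mul]
    · beta_reduce; rw [charFun_compl, map_sub, _root_.map_one]

theorem adjoin_gen : (StarAlgebra.adjoin ℂ (Set.range (gen θ))).topologicalClosure = ⊤ := by
  set T := (StarAlgebra.adjoin ℂ (Set.range (gen θ))).topologicalClosure
  have hcl : IsClosed (T : Set θ.dualCStarAction.CrossedProduct) :=
    StarSubalgebra.isClosed_topologicalClosure _
  have hgen : ∀ g, gen θ g ∈ T := fun g =>
    StarSubalgebra.le_topologicalClosure _ (StarAlgebra.subset_adjoin ℂ _ ⟨g, rfl⟩)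
  have hcoeff : ∀ f, coeffHom θ f ∈ T := fun f => by
    refine (coeffHom θ).map_mem_of_mem_topologicalClosure_adjoin (s := Set.range (domFun θ))
      hcl ?_ (by rw [adjoin_domFun]; trivial)
    rintro _ ⟨g, rfl⟩
    rw [← gen_mul_star]
    exact mul_mem (hgen g) (star_mem (hgen g))
  have halg : ∀ x, θ.dualCStarAction.maxSeminorm.toCompletion x ∈ T := fun x => by
    induction x using AlgCrossedProduct.induction with
    | zero => rw [map_zero]; exact zero_mem _
    | add x y hx hy => rw [map_add]; exact add_mem hx hy
    | single g a ha =>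
      rw [← coeff_mul_algGen ha, _root_.map_mul]
      exact mul_mem (hcoeff a) (hgen g)
  refine StarSubalgebra.ext fun x => iff_of_true ?_ trivial
  induction x using UniformSpace.Completion.induction_on with
  | hp => exact hcl
  | ih y => exact halg y

end Dual

end PartialAction

end

/-! ### The universal property -/

theorem theorem5 {G X : Type*} [Group G] (θ : PartialAction G X) :
    ∃ s : G → θ.dualCStarAction.CrossedProduct,
      θ.DefiningRelations s ∧
      (StarAlgebra.adjoin ℂ (Set.range s)).topologicalClosure = ⊤ ∧
      ∀ (B : Type*) [CStarAlgebra B] (S : G → B), θ.DefiningRelations S →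
        ∃! φ : θ.dualCStarAction.CrossedProduct →⋆ₐ[ℂ] B, ∀ g, φ (s g) = S g := by
  refine ⟨PartialAction.Dual.gen θ, PartialAction.Dual.definingRelations_gen,
    PartialAction.Dual.adjoin_gen, fun B _ S hS => ?_⟩
  obtain ⟨π, hπ⟩ := hS.exists_hom
  have hcov := hS.isCovariant hπ
  have hlift : ∀ g, hcov.lift (PartialAction.Dual.gen θ g) = S g := fun g => by
    refine (hcov.lift_single (PartialAction.Dual.domFun_mem g)).trans ?_
    rw [hπ, hS.partial_isometry]
  refine ⟨hcov.lift, hlift, fun φ hφ => StarAlgHom.ext fun x => ?_⟩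
  have hx : x ∈ (StarAlgebra.adjoin ℂ (Set.range (PartialAction.Dual.gen θ))).topologicalClosure :=
    PartialAction.Dual.adjoin_gen (θ := θ) ▸ trivial
  have hle : (StarAlgebra.adjoin ℂ (Set.range (PartialAction.Dual.gen θ))).topologicalClosure ≤
      StarAlgHom.equalizer φ hcov.lift := by
    refine StarSubalgebra.topologicalClosure_minimal (StarAlgebra.adjoin_le ?_)
      (isClosed_eq φ.continuous_of_cStarAlgebra hcov.lift.continuous_of_cStarAlgebra)
    rintro _ ⟨g, rfl⟩
    exact (hφ g).trans (hlift g).symm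
  exact hle hx
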